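/- Let $p_1,\ldots,p_t$ be distinct prime numbers, $N=p_1\cdots p_t$, and let $k\geq 2$ be an integer. Let $\mathcal M_k(N)$ and $\mathcal S_k(N)$ be the spaces of modular forms and of cusp forms of weight $k$ for $\Gamma_0(N)$, let $\mathcal S_k(N)^{\mathrm{new}}\subset\mathcal S_k(N)$ be the new subspace and $\mathcal E_k(N)\subset\mathcal M_k(N)$ the Eisenstein subspace (the Petersson orthogonal complement of $\mathcal S_k(N)$), and let $a_n(g)$ denote the $n$-th Fourier coefficient of $g$ at the cusp $\infty$. An eigenform is a nonzero simultaneous eigenvector of the Hecke operators $T_p$ for all primes $p\nmid N$ and $U_p$ for all primes $p\mid N$; a newform is an eigenform $f\in\mathcal S_k(N)^{\mathrm{new}}$ with $a_1(f)=1$. Let $f\in\mathcal S_k(N)^{\mathrm{new}}$ be a newform, let $K_f=\mathbb Q(a_n(f): n\geq 0)\subset\mathbb C$ be its coefficient field and $\mathcal O_f$ the ring of integers of $K_f$. Let $r\geq 0$ be an integer, $\lambda\subset\mathcal O_f$ a maximal ideal, and $E\in\mathcal E_k(N)$ an eigenform. For $x,y\in\mathbb C$ write $x\equiv y \bmod \lambda^r$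 if $x-y\in K_f$ and $\mathrm{ord}_\lambda(x-y)\geq r$ (with $\mathrm{ord}_\lambda(0)=\infty$). If $$a_n(f)\equiv a_n(E) \bmod \lambda^r$$ holds for all integers $n$ with $0\leq n\leq \frac{k}{12}\prod_{i=1}^t(p_i+1)$, then it holds for all integers $n\geq 0$. -/

import Mathlib

open scoped MatrixGroups UpperHalfPlane Modular
open CongruenceSubgroup MeasureTheory NumberField

noncomputable section

namespace EisCongr

/-- `Γ₀(N)`, as a subgroup of `GL₂(ℝ)`. -/
abbrev Gam0 (N : ℕ) : Subgroup (GL (Fin 2) ℝ) := (Gamma0 N).map (Matrix.SpecialLinearGroup.mapGL ℝ)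

/-- `M_k(N)`: modular forms of weight `k` for `Γ₀(N)`. -/
abbrev Mk (N : ℕ) (k : ℤ) : Type := ModularForm (Gam0 N) k

/-- `S_k(N)`: cusp forms of weight `k` for `Γ₀(N)`. -/
abbrev Sk (N : ℕ) (k : ℤ) : Type := CuspForm (Gam0 N) k

/-- The `n`-th Fourier coefficient at infinity, with respect to `q = exp (2πiτ)`. -/
def coeffInf (f : ℍ → ℂ) (n : ℕ) : ℂ := (UpperHalfPlane.qExpansion 1 f).coeff n

/-- The operator `f(τ) ↦ f(dτ)`, for `d > 0`. -/
def scale (d : ℕ) (f : ℍ → ℂ) : ℍ → ℂ :=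
  fun τ ↦ f (UpperHalfPlane.ofComplex ((d : ℂ) * (τ : ℂ)))

/-- The Hecke operator with prime index `p` in weight `k` and level `N`, that is `T_p` if `p ∤ N`
and `U_p` if `p ∣ N`:
`p⁻¹ ∑_{0 ≤ j < p} f((τ + j) / p)`, plus `p^(k-1) f(pτ)` if `p ∤ N`. -/
def hecke (N : ℕ) (k : ℤ) (p : ℕ) (f : ℍ → ℂ) : ℍ → ℂ :=
  fun τ ↦ (p : ℂ)⁻¹ * ∑ j ∈ Finset.range p, f (UpperHalfPlane.ofComplex (((τ : ℂ) + j) / p)) +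
    if p ∣ N then 0 else (p : ℂ) ^ (k - 1) * scale p f τ

/-- `f` is an eigenform for the Hecke algebra of level `N` (generated by the `T_p`, `p ∤ N`,
and the `U_p`, `p ∣ N`): a nonzero simultaneous eigenvector. -/
def IsHeckeEigen (N : ℕ) (k : ℤ) (f : ℍ → ℂ) : Prop :=
  f ≠ 0 ∧ ∀ p : ℕ, p.Prime → ∃ c : ℂ, hecke N k p f = c • f

/-- The (unnormalized) Petersson product of level `N`, the integral of
`conj (f τ) * g τ * (im τ) ^ k` against `dx dy / y ^ 2` over the fundamental domain `⋃ γ 𝒟` of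
`Γ₀(N)`, where `𝒟` is the standard fundamental domain of `SL₂(ℤ)` and `γ` runs through
representatives of `Γ₀(N) \ SL₂(ℤ)` (the inverses of representatives of `SL₂(ℤ) / Γ₀(N)`). -/
def peterssonProd (N : ℕ) (k : ℤ) (f g : ℍ → ℂ) : ℂ :=
  ∑ᶠ c : SL(2, ℤ) ⧸ Gamma0 N, ∫ τ in 𝒟, UpperHalfPlane.petersson k f g ((c.out)⁻¹ • τ)

/-- The old subspace of `S_k(N)`: the span of the forms `g(dτ)`, where `g ∈ S_k(M)`, `M` is a
proper divisor of `N` and `d` divides `N / M`. -/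
def oldSubspace (N : ℕ) (k : ℤ) : Submodule ℂ (Sk N k) :=
  Submodule.span ℂ {h | ∃ M d : ℕ, M * d ∣ N ∧ M ≠ N ∧ ∃ g : Sk M k, (h : ℍ → ℂ) = scale d g}

/-- `f` lies in the new subspace of `S_k(N)`, the orthogonal complement of the old subspace. -/
def IsNew {N : ℕ} {k : ℤ} (f : Sk N k) : Prop :=
  ∀ h ∈ oldSubspace N k, peterssonProd N k h f = 0

/-- Newforms of level `N` and weight `k`: normalized Hecke eigenforms in the new subspace. -/
structure IsNewform {N : ℕ} {k : ℤ} (f : Sk N k) : Prop where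
  isNew : IsNew f
  eigen : IsHeckeEigen N k f
  normalized : coeffInf f 1 = 1

/-- `E` lies in the Eisenstein subspace of `M_k(N)`, the orthogonal complement of `S_k(N)`. -/
def IsEisenstein {N : ℕ} {k : ℤ} (E : Mk N k) : Prop :=
  ∀ g : Sk N k, peterssonProd N k g E = 0

/-- The coefficient field `K_f = ℚ(a_0(f), a_1(f), …)`, a subfield of `ℂ`. -/
def coeffField (f : ℍ → ℂ) : IntermediateField ℚ ℂ :=
  IntermediateField.adjoin ℚ (Set.range (coeffInf f))

/-- `x ≡ y mod lam ^ r` for a maximal ideal `lam` of the ring of integers of `K ⊆ ℂ`: the number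
`x - y` lies in `K` and is of the form `a / s` with `a ∈ lam ^ r`, `s ∉ lam`, that is
`ord_lam (x - y) ≥ r` (with `ord_lam 0 = ∞`). -/
def CongrMod (K : IntermediateField ℚ ℂ) (lam : Ideal (𝓞 K)) (r : ℕ) (x y : ℂ) : Prop :=
  ∃ a ∈ lam ^ r, ∃ s : 𝓞 K, s ∉ lam ∧ ((s : K) : ℂ) * (x - y) = ((a : K) : ℂ)

end EisCongr

end

/-! The congruence is a Sturm bound over ℤ. Let μ be the index of Γ₀(N) in SL₂(ℤ), at most ∏(p_i+1),
and let 12m > μk. On all of M_k(N) each coefficient a_n is one fixed ℤ-linear combination of a_0, …,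
a_{m-1} (`exists_coeffInf_eq_sum_int`). Applied to f and E and subtracted, this carries congruences
of the first m coefficients to every n.

Everything rests on integrality over level one. A form F is a root of the product of X - F|γ over
the cosets, a monic polynomial whose coefficients are level one forms of weights ik, i ≤ μ. Level
one has an integral basis with leading terms 1, q, q², …, so a nonzero coefficient cannot vanish to
order m, over ℂ or modulo a prime. If F vanishes to order m, the relation therefore forces F = 0.
The same argument modulo p shows that a rational F with integral a_0, …, a_{m-1} is integral, once
its denominators are known to be bounded.

Bounded denominators and stability under Aut(ℂ) come from h = E₄(Nτ), which has an integral
expansion: the product of F with the different of h is a polynomial in h over level one. So F is a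
quotient of forms that are explicit over ℤ, and integrality controls the quotient. Finally, the
vectors (a_0, …, a_{m-1}) in ℤ^m that come from forms are a saturated lattice, so the integer-valued
functional a_n on it extends to ℤ^m. -/

/-! ### Power series: vanishing from an algebraic relation, and bounded denominators. -/

open PowerSeries in
/-- If a power series `x` over a field, highly divisible by `X`, is a root of a nonzero polynomial
whose nonzero coefficients are not so divisible, then `x = 0`. -/
theorem PowerSeries.eq_zero_of_X_pow_dvd_of_relation {F : Type*} [Field F] {m : ℕ} {x : F⟦X⟧}
    (hx : X ^ m ∣ x) (n : ℕ) (P : ℕ → F⟦X⟧)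
    (hP : ∀ i ≤ n, X ^ m ∣ P i → P i = 0) (hne : ∃ i ≤ n, P i ≠ 0)
    (hrel : ∑ i ∈ Finset.range (n + 1), P i * x ^ (n - i) = 0) : x = 0 := by
  induction n with
  | zero =>
    obtain ⟨i, hi, h0⟩ := hne
    obtain rfl : i = 0 := by omega
    simp at hrel
    exact absurd hrel h0
  | succ n ih =>
    rw [Finset.sum_range_succ] at hrel
    have key : ∑ i ∈ Finset.range (n + 1), P i * x ^ (n + 1 - i) =
        x * ∑ i ∈ Finset.range (n + 1), P i * x ^ (n - i) := by
      rw [Finset.mul_sum]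
      refine Finset.sum_congr rfl fun i hi ↦ ?_
      rw [Finset.mem_range] at hi
      rw [show n + 1 - i = (n - i) + 1 by omega, pow_succ]
      ring
    rw [key] at hrel
    -- The constant term of the relation is minus a multiple of x, so it inherits the factor X^m and
    -- vanishes; one factor x then cancels.
    have h0 : P (n + 1) = 0 := by
      refine hP _ le_rfl (hx.trans ⟨-∑ i ∈ Finset.range (n + 1), P i * x ^ (n - i), ?_⟩)
      simp at hrel
      linear_combination hrel
    rw [h0, zero_mul, add_zero] at hrel
    rcases mul_eq_zero.mp hrel with h | h
    · exact h
    · refine ih (fun i hi ↦ hP i (by omega)) ?_ h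
      obtain ⟨i, hi, hi'⟩ := hne
      refine ⟨i, ?_, hi'⟩
      by_contra hlt
      obtain rfl : i = n + 1 := by omega
      exact hi' h0

/-- A rational number all of whose powers have bounded denominators is an integer. -/
theorem Rat.exists_int_of_isAlmostIntegral {a : ℚ} {d : ℤ} (hd : d ≠ 0)
    (h : ∀ n : ℕ, ∃ z : ℤ, (z : ℚ) = d * a ^ n) : ∃ z : ℤ, (z : ℚ) = a := by
  have : IsAlmostIntegral ℤ a := by
    refine ⟨d, mem_nonZeroDivisors_of_ne_zero hd, fun n ↦ ?_⟩
    obtain ⟨z, hz⟩ := h n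
    exact ⟨z, by simp [hz]⟩
  obtain ⟨z, hz⟩ := IsIntegrallyClosed.isIntegral_iff.mp this.isIntegral
  exact ⟨z, by simpa using hz⟩

open PowerSeries in
/-- `ℤ⟦X⟧` is completely integrally closed in `ℚ⟦X⟧`. -/
theorem PowerSeries.mem_range_map_of_isAlmostIntegral {f : ℚ⟦X⟧} (hf : IsAlmostIntegral ℤ⟦X⟧ f) :
    f ∈ (algebraMap ℤ⟦X⟧ ℚ⟦X⟧).range := by
  have key : ∀ n, ∃ z : ℤ, (z : ℚ) = coeff n f := by
    intro n
    induction n using Nat.strong_induction_on with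
    | _ n ih =>
    choose! c hc using ih
    -- Subtracting the part of degree below n, integral by induction, keeps f almost integral and
    -- makes it X^n · u. If r clears the denominators of all powers, the lowest coefficient of r
    -- clears those of all powers of u(0).
    let t : ℤ⟦X⟧ := mk fun i ↦ if i < n then c i else 0
    have ht : IsAlmostIntegral ℤ⟦X⟧ (f - algebraMap ℤ⟦X⟧ ℚ⟦X⟧ t) :=
      (completeIntegralClosure ℤ⟦X⟧ ℚ⟦X⟧).sub_mem hf (Subalgebra.algebraMap_mem _ t)
    have hdvd : X ^ n ∣ f - algebraMap ℤ⟦X⟧ ℚ⟦X⟧ t := by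
      rw [X_pow_dvd_iff]
      intro m hm
      simp [PowerSeries.algebraMap_apply'', t, hm, hc m hm]
    obtain ⟨u, hu⟩ := hdvd
    have hu0 : coeff n f = coeff 0 u := by
      have := congrArg (coeff n) hu
      rw [coeff_X_pow_mul'] at this
      simpa [PowerSeries.algebraMap_apply'', t] using this
    obtain ⟨r, hr, hr'⟩ := ht
    have hr0 : r ≠ 0 := nonZeroDivisors.ne_zero hr
    obtain ⟨s, hs⟩ := X_pow_order_dvd (φ := r)
    set e := r.order.toNat
    have hs0 : coeff 0 s ≠ 0 := by
      have h1 : coeff e r ≠ 0 := coeff_order (by simpa using hr0)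
      rwa [hs, coeff_X_pow_mul', if_pos le_rfl, Nat.sub_self] at h1
    rw [hu0]
    refine Rat.exists_int_of_isAlmostIntegral hs0 fun m ↦ ?_
    obtain ⟨w, hw⟩ := hr' m
    refine ⟨coeff (e + n * m) w, ?_⟩
    have := congrArg (coeff (e + n * m)) hw
    rw [hu, Algebra.smul_def, hs, mul_pow, ← pow_mul] at this
    rw [show (algebraMap ℤ⟦X⟧ ℚ⟦X⟧) (X ^ e * s) * (X ^ (n * m) * u ^ m) =
      X ^ (e + n * m) * ((algebraMap ℤ⟦X⟧ ℚ⟦X⟧) s * u ^ m) by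
        simp [PowerSeries.algebraMap_apply'']; ring, coeff_X_pow_mul', if_pos le_rfl,
        Nat.sub_self] at this
    rw [PowerSeries.algebraMap_apply'', PowerSeries.algebraMap_apply'', coeff_map,
      coeff_zero_eq_constantCoeff_apply, map_mul, map_pow, ← coeff_zero_eq_constantCoeff_apply,
      ← coeff_zero_eq_constantCoeff_apply, coeff_map] at this
    simpa using this
  choose c hc using key
  exact ⟨mk c, by ext n; simp [PowerSeries.algebraMap_apply'', hc]⟩

open PowerSeries in
/-- The power series with rational coefficients of bounded denominator. -/
def PowerSeries.bddDenom : Subalgebra ℚ ℚ⟦X⟧ where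
  carrier := {f | ∃ D : ℤ, D ≠ 0 ∧ (D : ℚ⟦X⟧) * f ∈ (algebraMap ℤ⟦X⟧ ℚ⟦X⟧).range}
  mul_mem' := by
    rintro a b ⟨D, hD, ha⟩ ⟨E, hE, hb⟩
    refine ⟨D * E, mul_ne_zero hD hE, ?_⟩
    have := mul_mem ha hb
    rwa [mul_mul_mul_comm, ← Int.cast_mul] at this
  add_mem' := by
    rintro a b ⟨D, hD, ha⟩ ⟨E, hE, hb⟩
    refine ⟨D * E, mul_ne_zero hD hE, ?_⟩
    have := add_mem (mul_mem (intCast_mem _ E) ha) (mul_mem (intCast_mem _ D) hb)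
    convert this using 1
    push_cast
    ring
  algebraMap_mem' r := by
    refine ⟨r.den, by exact_mod_cast r.den_ne_zero, ?_⟩
    convert intCast_mem (algebraMap ℤ⟦X⟧ ℚ⟦X⟧).range r.num using 1
    have : ((r.den : ℚ)) * r = r.num := by rw [mul_comm]; exact Rat.mul_den_eq_num r
    rw [← map_intCast (algebraMap ℚ ℚ⟦X⟧) r.num, ← this, map_mul]
    simp

open PowerSeries in
theorem PowerSeries.map_mem_bddDenom (f : ℤ⟦X⟧) : map (Int.castRingHom ℚ) f ∈ bddDenom :=
  ⟨1, one_ne_zero, f, by simp [PowerSeries.algebraMap_apply'']⟩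

open PowerSeries in
/-- A series in the fraction field of the series with bounded denominators, integral over the
latter, has bounded denominators. -/
theorem PowerSeries.mem_bddDenom_of_relation {f G : ℚ⟦X⟧} (hG : G ∈ bddDenom) (hG0 : G ≠ 0)
    (hGf : G * f ∈ bddDenom) (n : ℕ) (P : ℕ → ℚ⟦X⟧) (hP : ∀ i ≤ n, P i ∈ bddDenom) (hP0 : P 0 = 1)
    (hrel : ∑ i ∈ Finset.range (n + 1), P i * f ^ (n - i) = 0) : f ∈ bddDenom := by
  choose! d hd0 hd using hP
  set D : ℤ := ∏ i ∈ Finset.range (n + 1), d i with hD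
  have hD0 : D ≠ 0 := Finset.prod_ne_zero_iff.mpr fun i hi ↦ hd0 i (by simpa [Nat.lt_succ_iff] using hi)
  -- D is a common denominator of the P_i, so D^i P_i is integral for i ≥ 1, and these are the
  -- coefficients of a monic equation for D f.
  have hDP : ∀ i < n, ∃ Q : ℤ⟦X⟧, algebraMap ℤ⟦X⟧ ℚ⟦X⟧ Q = (D : ℚ⟦X⟧) ^ (i + 1) * P (i + 1) := by
    intro i hi
    have h1 := hd (i + 1) hi
    have h2 : d (i + 1) ∣ D ^ (i + 1) :=
      (Finset.dvd_prod_of_mem d (Finset.mem_range.mpr (by omega))).trans (dvd_pow_self D (by omega))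
    obtain ⟨e, he⟩ := h2
    obtain ⟨Q, hQ⟩ := mul_mem (intCast_mem (algebraMap ℤ⟦X⟧ ℚ⟦X⟧).range e) h1
    refine ⟨Q, hQ.trans ?_⟩
    have : (D : ℚ⟦X⟧) ^ (i + 1) = d (i + 1) * e := by exact_mod_cast congrArg (Int.cast : ℤ → ℚ⟦X⟧) he
    rw [this]; ring
  choose! Q hQ using hDP
  have hint : IsIntegral ℤ⟦X⟧ ((D : ℚ⟦X⟧) * f) := by
    refine ⟨Polynomial.X ^ n + ∑ i ∈ Finset.range n, Polynomial.C (Q i) * Polynomial.X ^ (n - (i + 1)),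
      Polynomial.monic_X_pow_add ?_, ?_⟩
    · rcases Nat.eq_zero_or_pos n with rfl | hn
      · simp
      refine lt_of_le_of_lt (Polynomial.degree_sum_le _ _) ?_
      rw [Finset.sup_lt_iff (by exact WithBot.bot_lt_coe _)]
      intro i hi
      refine lt_of_le_of_lt (Polynomial.degree_C_mul_X_pow_le _ _) ?_
      exact_mod_cast (by omega : n - (i + 1) < n)
    · rw [Polynomial.eval₂_add, Polynomial.eval₂_finsetSum, Polynomial.eval₂_X_pow]
      rw [Finset.sum_range_succ', hP0, one_mul, Nat.sub_zero] at hrel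
      have : ∑ i ∈ Finset.range n, Polynomial.eval₂ (algebraMap ℤ⟦X⟧ ℚ⟦X⟧) ((D : ℚ⟦X⟧) * f)
          (Polynomial.C (Q i) * Polynomial.X ^ (n - (i + 1))) =
          (D : ℚ⟦X⟧) ^ n * ∑ i ∈ Finset.range n, P (i + 1) * f ^ (n - (i + 1)) := by
        rw [Finset.mul_sum]
        refine Finset.sum_congr rfl fun i hi ↦ ?_
        rw [Finset.mem_range] at hi
        rw [Polynomial.eval₂_mul, Polynomial.eval₂_C, Polynomial.eval₂_X_pow, hQ i hi]
        conv_rhs => rw [show n = (i + 1) + (n - (i + 1)) by omega, pow_add]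
        rw [show (i + 1) + (n - (i + 1)) - (i + 1) = n - (i + 1) by omega]
        ring
      rw [this, mul_pow]
      linear_combination (D : ℚ⟦X⟧) ^ n * hrel
  have hmap : ∀ t : ℤ⟦X⟧, algebraMap ℤ⟦X⟧ ℚ⟦X⟧ t = 0 → t = 0 := fun t ht ↦ by
    refine PowerSeries.map_injective (Int.castRingHom ℚ) Int.cast_injective ?_
    simpa [PowerSeries.algebraMap_apply''] using ht
  have hmap' : ∀ z : ℤ, algebraMap ℤ⟦X⟧ ℚ⟦X⟧ z = 0 → z = 0 := fun z hz ↦ by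
    have := congrArg (coeff 0) (hmap _ hz)
    simpa using this
  obtain ⟨a, ha0, A, hA⟩ := hG
  obtain ⟨b, hb0, B, hB⟩ := hGf
  have hQ0 : ∀ {z : ℤ}, z ≠ 0 → (z : ℚ⟦X⟧) ≠ 0 := fun {z} hz h ↦ hz <| hmap' z <| by
    rw [map_intCast, h]
  -- With A = aG and B = bGf integral, (A b)(D f) = a D B: the integral element D f lies in the
  -- fraction field of ℤ⟦X⟧, hence is almost integral.
  have hfD : (D : ℚ⟦X⟧) * f ∈ (algebraMap ℤ⟦X⟧ ℚ⟦X⟧).range := by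
    refine mem_range_map_of_isAlmostIntegral (hint.isAlmostIntegral_of_exists_smul_mem_range
      ⟨A * b, mem_nonZeroDivisors_of_ne_zero ?_, a * D * B, ?_⟩)
    · intro h
      have := congrArg (algebraMap ℤ⟦X⟧ ℚ⟦X⟧) h
      rw [map_mul, hA, map_intCast, map_zero] at this
      exact mul_ne_zero (mul_ne_zero (hQ0 ha0) hG0) (hQ0 hb0) this
    · rw [Algebra.smul_def, map_mul, map_mul, map_mul, hA, hB, map_intCast, map_intCast, map_intCast]
      ring
  exact ⟨D, hD0, hfD⟩

/-! ### Field automorphisms of ℂ and integral functionals on spaces of series. -/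

/-- A complex number fixed by all field automorphisms of `ℂ` is rational. -/
theorem Complex.exists_rat_of_forall_algEquiv_apply_eq {x : ℂ} (hx : ∀ σ : ℂ ≃ₐ[ℚ] ℂ, σ x = x) :
    ∃ q : ℚ, (q : ℂ) = x := by
  by_contra hcon
  have hbot : x ∉ (⊥ : IntermediateField ℚ ℂ) := by
    rw [IntermediateField.mem_bot]
    rintro ⟨q, rfl⟩
    exact hcon ⟨q, by simp⟩
  -- F is a maximal subfield avoiding x. It will turn out that ℂ is algebraic, hence Galois, over F;
  -- as x is fixed by every automorphism over F, it then lies in F after all.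
  obtain ⟨F, -, hF⟩ := zorn_le_nonempty₀ {F : IntermediateField ℚ ℂ | x ∉ F} (fun c hc hchain y hy ↦ by
    refine ⟨sSup c, ?_, fun z hz ↦ le_sSup hz⟩
    have : Nonempty c := ⟨⟨y, hy⟩⟩
    rw [Set.mem_ofPred_eq, sSup_eq_iSup', ← SetLike.mem_coe,
      IntermediateField.coe_iSup_of_directed hchain.directed, Set.mem_iUnion]
    rintro ⟨⟨F, hF⟩, hxF⟩
    exact hc hF hxF) ⊥ hbot
  have hxF : x ∉ F := hF.prop
  have hmax : ∀ y : ℂ, y ∉ F → x ∈ IntermediateField.adjoin F {y} := by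
    intro y hy
    by_contra h
    have hle : F ≤ (IntermediateField.adjoin F {y}).restrictScalars ℚ := by
      intro z hz
      exact (IntermediateField.adjoin F {y}).algebraMap_mem ⟨z, hz⟩
    have := hF.le_of_ge (y := (IntermediateField.adjoin F {y}).restrictScalars ℚ) h hle
    exact hy (this (IntermediateField.mem_adjoin_simple_self F y))
  -- By maximality x lies in F(y), a rational function field, where every element outside F is
  -- transcendental.
  have htr : ∀ y : ℂ, Transcendental F y → Transcendental F x := by
    intro y hy
    have hyF : y ∉ F := fun h ↦ hy (isAlgebraic_algebraMap (⟨y, h⟩ : F))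
    have hxy := hmax y hyF
    let e := RatFunc.algEquivOfTranscendental y hy
    have : Transcendental F (e.symm ⟨x, hxy⟩) := by
      refine RatFunc.transcendental_of_ne_C _ ?_
      rintro ⟨c, hc⟩
      have h1 : (⟨x, hxy⟩ : IntermediateField.adjoin F {y}) = e (RatFunc.C c) := by
        rw [← hc, AlgEquiv.apply_symm_apply]
      rw [← RatFunc.algebraMap_eq_C, AlgEquiv.commutes] at h1
      have h2 : x = c := congrArg Subtype.val h1
      exact hxF (h2 ▸ c.2)
    intro hxalg
    apply this
    have h3 : IsAlgebraic F (⟨x, hxy⟩ : IntermediateField.adjoin F {y}) :=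
      (isAlgebraic_algHom_iff (IntermediateField.adjoin F {y}).val Subtype.val_injective).mp hxalg
    exact h3.algHom e.symm.toAlgHom
  -- Otherwise x lies in F(x²) by maximality, and the variable of a rational function field would be
  -- a square, against the parity of degrees.
  have hxalg : IsAlgebraic F x := by
    by_contra hx'
    have hx2 : x ^ 2 ∉ F := fun h ↦ hx' ⟨Polynomial.X ^ 2 - Polynomial.C ⟨x ^ 2, h⟩,
      Polynomial.X_pow_sub_C_ne_zero two_pos _, by simp⟩
    have hmem := hmax _ hx2
    have h2 : Transcendental F (x ^ 2) := Transcendental.pow hx' two_pos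
    let e := RatFunc.algEquivOfTranscendental (x ^ 2) h2
    let u := e.symm ⟨x, hmem⟩
    have hu : u ^ 2 = RatFunc.X := by
      rw [← map_pow, AlgEquiv.symm_apply_eq]
      ext
      simp [e]
    have hu0 : u ≠ 0 := by
      rintro h
      simp only [h, ne_eq, OfNat.ofNat_ne_zero, not_false_eq_true, zero_pow] at hu
      exact RatFunc.X_ne_zero hu.symm
    have := congrArg RatFunc.intDegree hu
    rw [pow_two, RatFunc.intDegree_mul hu0 hu0, RatFunc.intDegree_X] at this
    omega
  have halg : Algebra.IsAlgebraic F ℂ := ⟨fun y ↦ by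
    by_contra hy
    exact htr y hy hxalg⟩
  have : IsAlgClosure F ℂ := ⟨inferInstance, halg⟩
  have : IsGalois F ℂ := inferInstance
  have := (InfiniteGalois.mem_range_algebraMap_iff_fixed (k := F) x).mpr
    fun σ ↦ hx (σ.restrictScalars ℚ)
  obtain ⟨y, rfl⟩ := this
  exact hxF y.2

/-- If the quotient by a submodule of a finite free `ℤ`-module is torsion-free, functionals on the
submodule extend. -/
theorem Submodule.exists_extension_of_saturated {ι : Type*} [Finite ι] (L : Submodule ℤ (ι → ℤ))
    (hL : ∀ (D : ℤ) (v : ι → ℤ), D ≠ 0 → D • v ∈ L → v ∈ L) (φ : L →ₗ[ℤ] ℤ) :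
    ∃ ψ : (ι → ℤ) →ₗ[ℤ] ℤ, ∀ v : L, ψ v = φ v := by
  have : Module.IsTorsionFree ℤ ((ι → ℤ) ⧸ L) := by
    refine Module.IsTorsionFree.of_smul_eq_zero fun D x h ↦ ?_
    induction x using Submodule.Quotient.induction_on with
    | _ v =>
    rw [← Submodule.Quotient.mk_smul, Submodule.Quotient.mk_eq_zero] at h
    by_cases hD : D = 0
    · exact Or.inl hD
    · exact Or.inr ((Submodule.Quotient.mk_eq_zero L).mpr (hL D v hD h))
  have : Module.Free ℤ ((ι → ℤ) ⧸ L) := Module.free_of_finite_type_torsion_free'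
  -- The quotient is free, so the quotient map has a section s, and v - s(v mod L) is a projection
  -- onto L.
  obtain ⟨s, hs⟩ := Module.projective_lifting_property L.mkQ LinearMap.id L.mkQ_surjective
  let π : (ι → ℤ) →ₗ[ℤ] (ι → ℤ) := LinearMap.id - s ∘ₗ L.mkQ
  have hmem : ∀ v, π v ∈ L := fun v ↦ by
    rw [← Submodule.Quotient.mk_eq_zero, ← Submodule.mkQ_apply, LinearMap.sub_apply, map_sub,
      LinearMap.comp_apply, LinearMap.congr_fun hs (L.mkQ v) |> (show L.mkQ (s (L.mkQ v)) = _ from ·)]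
    exact sub_self _
  refine ⟨φ ∘ₗ LinearMap.codRestrict L π hmem, fun v ↦ ?_⟩
  rw [LinearMap.comp_apply]
  congr 1
  ext1
  have : L.mkQ v = 0 := by simp
  change (v : ι → ℤ) - s (L.mkQ v) = v
  rw [this, map_zero, sub_zero]

open PowerSeries in
/-- Let `V` be a space of complex power series that is stable under field automorphisms of `ℂ`
and whose elements are determined by their first coefficients. If integrality of elements of
`V ∩ ℚ⟦X⟧` can be read off from these, then every coefficient is, on `V`, an integral combination
of them. -/
theorem PowerSeries.exists_coeff_eq_sum_int (V : Submodule ℂ ℂ⟦X⟧) (m : ℕ)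
    (hinj : ∀ f ∈ V, (∀ i < m, coeff i f = 0) → f = 0)
    (hσ : ∀ σ : ℂ ≃ₐ[ℚ] ℂ, ∀ f ∈ V, map (σ : ℂ →+* ℂ) f ∈ V)
    (hint : ∀ f : ℚ⟦X⟧, map (algebraMap ℚ ℂ) f ∈ V → (∀ i < m, ∃ z : ℤ, (z : ℚ) = coeff i f) →
      ∀ i, ∃ z : ℤ, (z : ℚ) = coeff i f) (n : ℕ) :
    ∃ z : Fin m → ℤ, ∀ f ∈ V, coeff n f = ∑ i : Fin m, (z i : ℂ) * coeff (i : ℕ) f := by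
  classical
  -- A minimal set S of coordinates that determine elements of V yields a basis g of V dual to the
  -- coefficients in S.
  let good : Set (Finset (Fin m)) := {S | ∀ f ∈ V, (∀ i ∈ S, coeff (i : ℕ) f = 0) → f = 0}
  obtain ⟨S, hS⟩ := (Set.toFinite good).exists_minimal
    ⟨Finset.univ, fun f hf h ↦ hinj f hf fun i hi ↦ h ⟨i, hi⟩ (Finset.mem_univ _)⟩
  have hSgood : ∀ f ∈ V, (∀ i ∈ S, coeff (i : ℕ) f = 0) → f = 0 := hS.prop
  have hdual : ∀ s ∈ S, ∃ f ∈ V, ∀ i ∈ S, coeff (i : ℕ) f = if i = s then 1 else 0 := by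
    intro s hs
    have hnot : S.erase s ∉ good := fun h ↦
      (Finset.erase_ssubset hs).not_subset (hS.le_of_le h (Finset.erase_subset s S))
    simp only [good, Set.mem_ofPred_eq, not_forall] at hnot
    obtain ⟨f, hf, h0, hne⟩ := hnot
    have hs0 : coeff (s : ℕ) f ≠ 0 := fun h ↦ hne <| hSgood f hf fun i hi ↦ by
      by_cases his : i = s
      · exact his ▸ h
      · exact h0 i (Finset.mem_erase.mpr ⟨his, hi⟩)
    refine ⟨(coeff (s : ℕ) f)⁻¹ • f, V.smul_mem _ hf, fun i hi ↦ ?_⟩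
    split_ifs with his
    · simp [his, hs0]
    · simp [h0 i (Finset.mem_erase.mpr ⟨his, hi⟩)]
  choose! g hgV hg using hdual
  have hgrat : ∀ s ∈ S, ∃ u : ℚ⟦X⟧, map (algebraMap ℚ ℂ) u = g s := by
    intro s hs
    -- An automorphism preserves the values 0 and 1 of the S-coordinates, which determine g s; so g
    -- s is Galois-invariant and has rational coefficients.
    have hfix : ∀ σ : ℂ ≃ₐ[ℚ] ℂ, map (σ : ℂ →+* ℂ) (g s) = g s := fun σ ↦ by
      rw [← sub_eq_zero]
      refine hSgood _ (V.sub_mem (hσ σ _ (hgV s hs)) (hgV s hs)) fun i hi ↦ ?_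
      rw [map_sub, coeff_map, hg s hs i hi]
      split_ifs <;> simp
    have : ∀ j, ∃ q : ℚ, (q : ℂ) = coeff j (g s) := fun j ↦
      Complex.exists_rat_of_forall_algEquiv_apply_eq fun σ ↦ by
        have := congrArg (coeff j) (hfix σ)
        rwa [coeff_map] at this
    choose q hq using this
    exact ⟨mk q, by ext j; simp [hq]⟩
  choose! u hu using hgrat
  have hexp : ∀ f ∈ V, f = ∑ s ∈ S, coeff (s : ℕ) f • g s := fun f hf ↦ by
    rw [← sub_eq_zero]
    refine hSgood _ (V.sub_mem hf (V.sum_mem fun s hs ↦ V.smul_mem _ (hgV s hs))) fun i hi ↦ ?_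
    rw [map_sub, map_sum, Finset.sum_eq_single_of_mem i hi, sub_eq_zero]
    · simp [hg i hi i hi]
    · intro s hs his
      simp [hg s hs i hi, his.symm]
  have hVint : ∀ f ∈ V, (∀ i < m, ∃ z : ℤ, (z : ℂ) = coeff i f) → ∀ i, ∃ z : ℤ, (z : ℂ) = coeff i f := by
    intro f hf hz
    choose! z hz using hz
    have hfu : map (algebraMap ℚ ℂ) (∑ s ∈ S, (z (s : ℕ) : ℚ) • u s) = f := by
      conv_rhs => rw [hexp f hf]
      rw [map_sum]
      refine Finset.sum_congr rfl fun s hs ↦ ?_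
      rw [← hz s s.2, ← hu s hs]
      ext
      simp
    have hcoe : ∀ i, ((coeff i (∑ s ∈ S, (z (s : ℕ) : ℚ) • u s) : ℚ) : ℂ) = coeff i f := fun i ↦ by
      have := congrArg (coeff i) hfu
      rwa [coeff_map] at this
    intro i
    obtain ⟨w, hw⟩ := hint (∑ s ∈ S, (z (s : ℕ) : ℚ) • u s) (by rwa [hfu]) (fun i hi ↦ ⟨z i, by
      have h := hcoe i
      rw [← hz i hi] at h
      exact_mod_cast h.symm⟩) i
    exact ⟨w, by rw [← hcoe i, ← hw]; simp⟩
  let L : Submodule ℤ (Fin m → ℤ) :=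
    { carrier := {v | ∃ f ∈ V, ∀ i : Fin m, coeff (i : ℕ) f = v i}
      add_mem' := by
        rintro a b ⟨f, hf, hfa⟩ ⟨f', hf', hfb⟩
        exact ⟨f + f', V.add_mem hf hf', fun i ↦ by simp [hfa, hfb]⟩
      zero_mem' := ⟨0, V.zero_mem, by simp⟩
      smul_mem' := by
        rintro c a ⟨f, hf, hfa⟩
        exact ⟨(c : ℂ) • f, V.smul_mem _ hf, fun i ↦ by simp [hfa]⟩ }
  -- V is a complex vector space, so dividing by D stays inside it; this is the saturation that lets
  -- functionals extend.
  have hLsat : ∀ (D : ℤ) (v : Fin m → ℤ), D ≠ 0 → D • v ∈ L → v ∈ L := by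
    rintro D v hD ⟨f, hf, hfv⟩
    refine ⟨(D : ℂ)⁻¹ • f, V.smul_mem _ hf, fun i ↦ ?_⟩
    have : (D : ℂ) ≠ 0 := by exact_mod_cast hD
    simp [hfv, this]
  have hL : ∀ v : L, ∃ a : ℤ, ∀ f ∈ V, (∀ i : Fin m, coeff (i : ℕ) f = v.1 i) → coeff n f = a := by
    rintro ⟨v, f, hf, hfv⟩
    obtain ⟨a, ha⟩ := hVint f hf (fun i hi ↦ ⟨v ⟨i, hi⟩, (hfv ⟨i, hi⟩).symm⟩) n
    refine ⟨a, fun f' hf' hf'v ↦ ?_⟩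
    have : f' - f = 0 := hinj _ (V.sub_mem hf' hf) fun i hi ↦ by
      rw [map_sub, hfv ⟨i, hi⟩, hf'v ⟨i, hi⟩, sub_self]
    rw [sub_eq_zero.mp this, ha]
  choose a ha using hL
  let φ : L →ₗ[ℤ] ℤ :=
    { toFun := a
      map_add' := by
        rintro ⟨v, f, hf, hfv⟩ ⟨v', f', hf', hfv'⟩
        have h := ha ⟨v, f, hf, hfv⟩ f hf hfv
        have h' := ha ⟨v', f', hf', hfv'⟩ f' hf' hfv'
        have h'' := ha (⟨v, f, hf, hfv⟩ + ⟨v', f', hf', hfv'⟩) (f + f') (V.add_mem hf hf')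
          fun i ↦ by simp [hfv, hfv']
        rw [map_add, h, h'] at h''
        exact_mod_cast h''.symm
      map_smul' := by
        rintro c ⟨v, f, hf, hfv⟩
        have h := ha ⟨v, f, hf, hfv⟩ f hf hfv
        have h'' := ha (c • ⟨v, f, hf, hfv⟩) ((c : ℂ) • f) (V.smul_mem _ hf)
          fun i ↦ by simp [hfv]
        rw [coeff_smul, h] at h''
        rw [RingHom.id_apply, smul_eq_mul]
        rw [smul_eq_mul] at h''
        exact_mod_cast h''.symm }
  obtain ⟨ψ, hψ⟩ := L.exists_extension_of_saturated hLsat φ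
  refine ⟨fun i ↦ ψ (Pi.single i 1), ?_⟩
  have hψsum : ∀ v : Fin m → ℤ, ψ v = ∑ i, ψ (Pi.single i 1) * v i := fun v ↦ by
    rw [LinearMap.pi_apply_eq_sum_univ]
    exact Finset.sum_congr rfl fun i _ ↦ by
      rw [smul_eq_mul, mul_comm]
      congr 2
      ext j
      simp [Pi.single_apply, eq_comm]
  have hint' : ∀ f ∈ V, (∀ i < m, ∃ z : ℤ, (z : ℂ) = coeff i f) →
      coeff n f = ∑ i : Fin m, ((ψ (Pi.single i 1) : ℤ) : ℂ) * coeff (i : ℕ) f := by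
    intro f hf hz
    choose! z hz using hz
    have hv : (fun i : Fin m ↦ z i) ∈ L := ⟨f, hf, fun i ↦ (hz i i.2).symm⟩
    rw [ha ⟨_, hv⟩ f hf fun i ↦ (hz i i.2).symm]
    have h1 : a ⟨_, hv⟩ = ψ fun i : Fin m ↦ z i := (hψ ⟨_, hv⟩).symm
    rw [h1, hψsum]
    push_cast
    exact Finset.sum_congr rfl fun i _ ↦ by rw [hz i i.2]
  have hbasis : ∀ s ∈ S, coeff n (g s) =
      ∑ i : Fin m, ((ψ (Pi.single i 1) : ℤ) : ℂ) * coeff (i : ℕ) (g s) := by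
    intro s hs
    -- Clearing denominators in the first m coefficients suffices, as only those enter the
    -- hypothesis of `hint'`.
    let D : ℕ := ∏ i ∈ Finset.range m, (coeff i (u s)).den
    have hD : (D : ℂ) ≠ 0 := by
      exact_mod_cast Finset.prod_ne_zero_iff.mpr fun i _ ↦ (coeff i (u s)).den_ne_zero
    have h := hint' ((D : ℂ) • g s) (V.smul_mem _ (hgV s hs)) fun i hi ↦ by
      obtain ⟨e, he⟩ : (coeff i (u s)).den ∣ D := Finset.dvd_prod_of_mem _ (Finset.mem_range.mpr hi)
      refine ⟨e * (coeff i (u s)).num, ?_⟩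
      rw [coeff_smul, ← hu s hs, coeff_map, he]
      have : ((coeff i (u s)).num : ℚ) = coeff i (u s) * (coeff i (u s)).den :=
        (Rat.mul_den_eq_num _).symm
      have h2 : (((coeff i (u s)).num : ℤ) : ℂ) = ((coeff i (u s) : ℚ) : ℂ) * ((coeff i (u s)).den : ℂ) := by
        exact_mod_cast this
      push_cast
      rw [h2, smul_eq_mul, eq_ratCast]
      ring
    simp only [coeff_smul, smul_eq_mul, mul_left_comm _ (D : ℂ), ← Finset.mul_sum] at h
    exact mul_left_cancel₀ hD h
  intro f hf
  have hcoeff : ∀ j, coeff j f = ∑ s ∈ S, coeff (s : ℕ) f * coeff j (g s) := fun j ↦ by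
    conv_lhs => rw [hexp f hf]
    simp
  rw [hcoeff n, Finset.sum_congr rfl fun s hs ↦ by rw [hbasis s hs, Finset.mul_sum],
    Finset.sum_comm]
  refine Finset.sum_congr rfl fun i _ ↦ ?_
  rw [hcoeff i, Finset.mul_sum]
  exact Finset.sum_congr rfl fun s _ ↦ by ring

/-! ### The algebra of q-expansions and an integral basis in level one. -/

namespace EisCongr

open UpperHalfPlane ModularForm Function
open scoped Manifold

/-- The algebra of holomorphic functions on `ℍ` that are `1`-periodic and bounded at `i∞`. -/
def periodicFun : Subalgebra ℂ (ℍ → ℂ) where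
  carrier := {f | Periodic (f ∘ ofComplex) 1 ∧ MDiff f ∧ IsBoundedAtImInfty f}
  mul_mem' := by
    rintro f g ⟨h1, h2, h3⟩ ⟨h1', h2', h3'⟩
    refine ⟨fun z ↦ ?_, h2.mul h2', h3.mul h3'⟩
    have e := h1 z
    have e' := h1' z
    simp only [comp_apply] at e e'
    simp [e, e']
  add_mem' := by
    rintro f g ⟨h1, h2, h3⟩ ⟨h1', h2', h3'⟩
    refine ⟨fun z ↦ ?_, h2.add h2', h3.add h3'⟩
    have e := h1 z
    have e' := h1' z
    simp only [comp_apply] at e e'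
    simp [e, e']
  algebraMap_mem' c :=
    ⟨fun z ↦ rfl, fun _ ↦ mdifferentiableAt_const, Filter.const_boundedAtFilter _ c⟩

theorem analyticAt_cuspFunction {f : ℍ → ℂ} (hf : f ∈ periodicFun) :
    AnalyticAt ℂ (cuspFunction 1 f) 0 :=
  analyticAt_cuspFunction_zero one_pos (by exact_mod_cast hf.1) hf.2.1 hf.2.2

/-- The `q`-expansion as a homomorphism of algebras. -/
noncomputable def qHom : periodicFun →ₐ[ℂ] PowerSeries ℂ :=
  AlgHom.ofLinearMap
    { toFun f := qExpansion 1 f.1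
      map_add' f g := qExpansion_add (analyticAt_cuspFunction f.2) (analyticAt_cuspFunction g.2)
      map_smul' c f := qExpansion_smul (analyticAt_cuspFunction f.2) c }
    (qExpansion_one 1)
    (fun f g ↦ qExpansion_mul (analyticAt_cuspFunction f.2) (analyticAt_cuspFunction g.2))

theorem qHom_apply (f : periodicFun) : qHom f = qExpansion 1 (f : ℍ → ℂ) := rfl

theorem qHom_injective : Injective qHom :=
  (injective_iff_map_eq_zero qHom).mpr fun f hf ↦ Subtype.ext <|
    (qExpansion_eq_zero_iff one_pos (by exact_mod_cast f.2.1) f.2.2.1 f.2.2.2).mp hf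

/-- The space of modular forms of level `Γ` and weight `k`, as functions on `ℍ`. -/
def forms (Γ : Subgroup (GL (Fin 2) ℝ)) [Γ.HasDetOne] (k : ℤ) : Submodule ℂ (ℍ → ℂ) where
  carrier := {F | ∃ f : ModularForm Γ k, ⇑f = F}
  add_mem' := by
    rintro _ _ ⟨f, rfl⟩ ⟨g, rfl⟩
    exact ⟨f + g, rfl⟩
  zero_mem' := ⟨0, rfl⟩
  smul_mem' := by
    rintro c _ ⟨f, rfl⟩
    exact ⟨c • f, rfl⟩

section forms

variable {Γ : Subgroup (GL (Fin 2) ℝ)} [Γ.HasDetOne]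

theorem coe_mem_forms {k : ℤ} (f : ModularForm Γ k) : ⇑f ∈ forms Γ k := ⟨f, rfl⟩

theorem mul_mem_forms {k l m : ℤ} {F G : ℍ → ℂ} (hF : F ∈ forms Γ k) (hG : G ∈ forms Γ l)
    (h : k + l = m) : F * G ∈ forms Γ m := by
  subst h
  obtain ⟨f, rfl⟩ := hF
  obtain ⟨g, rfl⟩ := hG
  exact ⟨f.mul g, rfl⟩

theorem one_mem_forms {m : ℤ} (h : m = 0) : (1 : ℍ → ℂ) ∈ forms Γ m := by
  subst h
  exact ⟨1, rfl⟩

theorem pow_mem_forms {k m : ℤ} {F : ℍ → ℂ} (hF : F ∈ forms Γ k) (n : ℕ) (h : n * k = m) :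
    F ^ n ∈ forms Γ m := by
  subst h
  obtain ⟨f, rfl⟩ := hF
  exact ⟨f.pow n, coe_pow f n⟩

theorem forms_mono {Γ' : Subgroup (GL (Fin 2) ℝ)} [Γ'.HasDetOne] (h : Γ ≤ Γ') (k : ℤ) :
    forms Γ' k ≤ forms Γ k := by
  rintro _ ⟨f, rfl⟩
  exact ⟨{ toFun := f
           slash_action_eq' := fun γ hγ ↦ f.slash_action_eq' γ (h hγ)
           holo' := f.holo'
           bdd_at_cusps' := fun hc ↦ f.bdd_at_cusps' (hc.mono h) }, rfl⟩

theorem forms_le_periodicFun (hΓ : (1 : ℝ) ∈ Γ.strictPeriods) {k : ℤ} {F : ℍ → ℂ}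
    (hF : F ∈ forms Γ k) : F ∈ periodicFun := by
  obtain ⟨f, rfl⟩ := hF
  have : Fact (IsCusp OnePoint.infty Γ) := ⟨Γ.isCusp_of_mem_strictPeriods one_pos hΓ⟩
  exact ⟨by exact_mod_cast SlashInvariantFormClass.periodic_comp_ofComplex f hΓ,
    ModularFormClass.holo f, ModularFormClass.bdd_at_infty f⟩

end forms

/-- A family of integral power series with `b j = X ^ j + ⋯`. -/
def IsUnitriangular {d : ℕ} (b : Fin d → PowerSeries ℤ) : Prop :=
  ∀ j, (b j).coeff (j : ℕ) = 1 ∧ ∀ i < (j : ℕ), (b j).coeff i = 0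

/-- The leading terms lie in distinct degrees below m with coefficient 1, so the x_j are read off
degree by degree. The ring is arbitrary because this is needed both over ℂ and over ℤ/p. -/
theorem IsUnitriangular.eq_zero {d m : ℕ} {b : Fin d → PowerSeries ℤ} (hb : IsUnitriangular b)
    {R : Type*} [CommRing R] (x : Fin d → R) (hdm : d ≤ m)
    (h : PowerSeries.X ^ m ∣ ∑ j, x j • (b j).map (Int.castRingHom R)) : x = 0 := by
  rw [PowerSeries.X_pow_dvd_iff] at h
  suffices ∀ n (hn : n < d), x ⟨n, hn⟩ = 0 from funext fun j ↦ this j j.2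
  intro n
  induction n using Nat.strong_induction_on with
  | _ n ih =>
  intro hn
  have := h n (by omega)
  rw [map_sum, Finset.sum_eq_single ⟨n, hn⟩] at this
  · simpa [(hb ⟨n, hn⟩).1] using this
  · intro j _ hj
    rcases lt_or_gt_of_ne (fun h ↦ hj (Fin.ext h) : (j : ℕ) ≠ n) with hlt | hgt
    · simp [show x j = 0 from ih j hlt j.2]
    · simp [(hb j).2 n hgt]
  · simp

open EisensteinSeries

theorem exists_int_qExpansion_E₄ : ∃ A : PowerSeries ℤ,
    (1 + 240 * A).map (Int.castRingHom ℂ) = qExpansion 1 E₄ ∧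
    A = PowerSeries.mk fun n ↦ (ArithmeticFunction.sigma 3 n : ℤ) := by
  refine ⟨_, ?_, rfl⟩
  ext n
  rw [E_qExpansion_coeff _ ⟨2, rfl⟩, show bernoulli 4 = -1 / 30 by decide +kernel, map_add, map_one,
    map_mul, map_ofNat, show (240 : PowerSeries ℂ) = PowerSeries.C 240 from rfl, map_add,
    PowerSeries.coeff_C_mul, PowerSeries.coeff_one, PowerSeries.coeff_map, PowerSeries.coeff_mk]
  rcases eq_or_ne n 0 with rfl | hn
  · simp
  · simp [hn]
    norm_num

theorem exists_int_qExpansion_E₆ : ∃ B : PowerSeries ℤ,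
    (1 - 504 * B).map (Int.castRingHom ℂ) = qExpansion 1 E₆ ∧
    B = PowerSeries.mk fun n ↦ (ArithmeticFunction.sigma 5 n : ℤ) := by
  refine ⟨_, ?_, rfl⟩
  ext n
  rw [E_qExpansion_coeff _ ⟨3, rfl⟩, show bernoulli 6 = 1 / 42 by decide +kernel, map_sub, map_one,
    map_mul, map_ofNat, show (504 : PowerSeries ℂ) = PowerSeries.C 504 from rfl, map_sub,
    PowerSeries.coeff_C_mul, PowerSeries.coeff_one, PowerSeries.coeff_map, PowerSeries.coeff_mk]
  rcases eq_or_ne n 0 with rfl | hn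
  · simp
  · simp [hn]
    norm_num

/-- Holds divisor by divisor, by a check of residues modulo 12. It accounts for the linear terms in
the integrality of (E₄³ - E₆²)/1728. -/
theorem twelve_dvd_sigma (n : ℕ) :
    (12 : ℤ) ∣ 5 * (ArithmeticFunction.sigma 3 n : ℤ) + 7 * (ArithmeticFunction.sigma 5 n : ℤ) := by
  rw [ArithmeticFunction.sigma_apply, ArithmeticFunction.sigma_apply]
  push_cast
  rw [Finset.mul_sum, Finset.mul_sum, ← Finset.sum_add_distrib]
  refine Finset.dvd_sum fun d _ ↦ ?_
  have key : ∀ x : ZMod 12, 5 * x ^ 3 + 7 * x ^ 5 = 0 := by decide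
  have := key d
  refine (ZMod.intCast_zmod_eq_zero_iff_dvd _ 12).mp ?_
  push_cast
  exact this

/-- The `q`-expansion of the discriminant is integral. -/
theorem exists_int_qExpansion_discriminant : ∃ D : PowerSeries ℤ,
    D.map (Int.castRingHom ℂ) = qExpansion 1 discriminant := by
  obtain ⟨A, hA, hA'⟩ := exists_int_qExpansion_E₄
  obtain ⟨B, hB, hB'⟩ := exists_int_qExpansion_E₆
  choose c hc using twelve_dvd_sigma
  have hAB : 5 * A + 7 * B = 12 * PowerSeries.mk c := by
    ext n
    rw [hA', hB', show (5 : PowerSeries ℤ) = PowerSeries.C 5 from rfl,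
      show (7 : PowerSeries ℤ) = PowerSeries.C 7 from rfl,
      show (12 : PowerSeries ℤ) = PowerSeries.C 12 from rfl]
    rw [map_add, PowerSeries.coeff_C_mul, PowerSeries.coeff_C_mul, PowerSeries.coeff_C_mul,
      PowerSeries.coeff_mk, PowerSeries.coeff_mk, PowerSeries.coeff_mk]
    exact hc n
  have hE₄ := forms_le_periodicFun one_mem_strictPeriods_SL (coe_mem_forms E₄)
  have hE₆ := forms_le_periodicFun one_mem_strictPeriods_SL (coe_mem_forms E₆)
  have hΔ : qExpansion 1 discriminant = (1 / 1728 : ℂ) •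
      (qExpansion 1 E₄ ^ 3 - qExpansion 1 E₆ ^ 2) := by
    have h1 : discriminant = ((1 / 1728 : ℂ) • ((⟨_, hE₄⟩ : periodicFun) ^ 3 - ⟨_, hE₆⟩ ^ 2) :
        periodicFun) := by
      ext z
      rw [discriminant_eq_E₄_cube_sub_E₆_sq]
      simp [div_eq_inv_mul]
    rw [h1, ← qHom_apply, map_smul, map_sub, map_pow, map_pow]
    rfl
  -- This is ((1+240A)³ - (1-504B)²)/1728; its linear part 720A + 1008B = 144(5A + 7B) is 1728 times
  -- the series of c.
  refine ⟨PowerSeries.mk c + 100 * A ^ 2 + 8000 * A ^ 3 - 147 * B ^ 2, ?_⟩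
  have h2 : 1728 * (PowerSeries.mk c + 100 * A ^ 2 + 8000 * A ^ 3 - 147 * B ^ 2) =
      (1 + 240 * A) ^ 3 - (1 - 504 * B) ^ 2 := by
    linear_combination -144 * hAB
  have h3 := congrArg (PowerSeries.map (Int.castRingHom ℂ)) h2
  rw [map_sub, map_pow, map_pow, hA, hB, map_mul] at h3
  rw [hΔ, ← h3, map_ofNat, show (1728 : PowerSeries ℂ) = PowerSeries.C 1728 from rfl,
    ← PowerSeries.smul_eq_C_mul, smul_smul]
  norm_num

/-- An integral unitriangular basis of the modular forms of level one. -/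
theorem exists_levelOne_basis (w : ℕ) : ∃ (d : ℕ) (b : Fin d → PowerSeries ℤ),
    12 * d ≤ w + 12 ∧ IsUnitriangular b ∧
    (∀ j, ∃ F ∈ forms 𝒮ℒ w, qExpansion 1 F = (b j).map (Int.castRingHom ℂ)) ∧
    ∀ F ∈ forms 𝒮ℒ w, ∃ x : Fin d → ℂ,
      qExpansion 1 F = ∑ j, x j • (b j).map (Int.castRingHom ℂ) := by
  induction w using Nat.strong_induction_on with
  | _ w ih =>
  have hzero : (∀ f : ModularForm 𝒮ℒ w, f = 0) → ∃ (d : ℕ) (b : Fin d → PowerSeries ℤ),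
      12 * d ≤ w + 12 ∧ IsUnitriangular b ∧
      (∀ j, ∃ F ∈ forms 𝒮ℒ w, qExpansion 1 F = (b j).map (Int.castRingHom ℂ)) ∧
      ∀ F ∈ forms 𝒮ℒ w, ∃ x : Fin d → ℂ,
        qExpansion 1 F = ∑ j, x j • (b j).map (Int.castRingHom ℂ) := fun h ↦
    ⟨0, Fin.elim0, by simp, fun j ↦ j.elim0, fun j ↦ j.elim0, by
      rintro _ ⟨f, rfl⟩
      exact ⟨0, by simp [h f, qExpansion_zero]⟩⟩
  rcases Nat.even_or_odd w with hw | hw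
  swap
  · exact hzero fun f ↦ levelOne_odd_weight_eq_zero (by exact_mod_cast hw) f
  rcases eq_or_ne w 2 with rfl | hw2
  · exact hzero fun f ↦ rank_zero_iff_forall_zero.mp levelOne_weight_two_rank_zero f
  -- Every even weight other than 2 is 4a + 6b, and E₄^a E₆^b is integral with constant term 1.
  obtain ⟨e, he⟩ : ∃ e : PowerSeries ℤ, e.coeff 0 = 1 ∧
      ∃ F ∈ forms 𝒮ℒ w, qExpansion 1 F = e.map (Int.castRingHom ℂ) := by
    obtain ⟨a, b, hab⟩ : ∃ a b : ℕ, w = 4 * a + 6 * b := by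
      obtain ⟨m, rfl⟩ := hw
      rcases Nat.even_or_odd' m with ⟨n, rfl | rfl⟩
      · exact ⟨n, 0, by omega⟩
      · exact ⟨n - 1, 1, by omega⟩
    obtain ⟨A, hA, hA'⟩ := exists_int_qExpansion_E₄
    obtain ⟨B, hB, hB'⟩ := exists_int_qExpansion_E₆
    have hE₄ := forms_le_periodicFun one_mem_strictPeriods_SL (coe_mem_forms E₄)
    have hE₆ := forms_le_periodicFun one_mem_strictPeriods_SL (coe_mem_forms E₆)
    refine ⟨(1 + 240 * A) ^ a * (1 - 504 * B) ^ b, by simp [hA', hB'], E₄ ^ a * E₆ ^ b,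
      mul_mem_forms (pow_mem_forms (coe_mem_forms E₄) a rfl) (pow_mem_forms (coe_mem_forms E₆) b rfl)
        (by rw [hab]; push_cast; ring), ?_⟩
    rw [map_mul, map_pow, map_pow, hA, hB]
    have := map_mul qHom ((⟨_, hE₄⟩ : periodicFun) ^ a) (⟨_, hE₆⟩ ^ b)
    rwa [map_pow, map_pow] at this
  obtain ⟨he0, E, hE, hEe⟩ := he
  -- Removing the constant term leaves a cusp form, which is divisible by the discriminant; this
  -- lowers the weight by 12 and drives the induction.
  have hcusp : ∀ f : ModularForm 𝒮ℒ w, ∃ g : ModularForm 𝒮ℒ ((w : ℤ) - 12), qExpansion 1 f =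
      (qExpansion 1 f).coeff 0 • e.map (Int.castRingHom ℂ) +
        qExpansion 1 discriminant * qExpansion 1 g := by
    intro f
    obtain ⟨E', rfl⟩ := hE
    let f' : ModularForm 𝒮ℒ w := f - (qExpansion 1 f).coeff 0 • E'
    have hf' : qExpansion 1 f' = qExpansion 1 f - (qExpansion 1 f).coeff 0 • e.map (Int.castRingHom ℂ) := by
      rw [← hEe, ← ModularForm.qExpansion_smul one_pos one_mem_strictPeriods_SL,
        ← FunLike.coe_smul, ← ModularForm.qExpansion_sub one_pos one_mem_strictPeriods_SL,
        ← FunLike.coe_sub]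
    have h0 : (qExpansion 1 f').coeff 0 = 0 := by
      rw [hf', map_sub, PowerSeries.coeff_smul, PowerSeries.coeff_map, he0]
      simp
    refine ⟨CuspForm.discriminantEquiv (toCuspForm f' h0), ?_⟩
    rw [← qExpansion_eq_qExpansion_discriminant_mul f' h0, hf']
    ring
  obtain ⟨D, hD⟩ := exists_int_qExpansion_discriminant
  rcases lt_or_ge w 12 with hlt | hge
  · refine ⟨1, fun _ ↦ e, by omega, fun j ↦ ?_, fun _ ↦ ⟨E, hE, hEe⟩, ?_⟩
    · obtain rfl : j = 0 := Subsingleton.elim _ _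
      exact ⟨he0, by simp⟩
    · rintro _ ⟨f, rfl⟩
      obtain ⟨g, hg⟩ := hcusp f
      have hg0 : g = 0 := rank_zero_iff_forall_zero.mp (levelOne_neg_weight_rank_zero (by omega)) g
      refine ⟨fun _ ↦ (qExpansion 1 f).coeff 0, ?_⟩
      conv_lhs => rw [hg, hg0]
      simp [qExpansion_zero]
  · obtain ⟨d, b, hd, hb, hbF, hspan⟩ := ih (w - 12) (by omega)
    have hcast : ((w - 12 : ℕ) : ℤ) = (w : ℤ) - 12 := by omega
    have hD1 : D.coeff 1 = 1 ∧ D.coeff 0 = 0 := by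
      have h1 : ((D.coeff 1 : ℤ) : ℂ) = 1 := by
        rw [← discriminant_qExpansion_coeff_one, ← hD]; simp
      have h0 : ((D.coeff 0 : ℤ) : ℂ) = 0 := by
        rw [← PowerSeries.coeff_of_lt_order (φ := qExpansion 1 discriminant) 0
          (by rw [discriminant_qExpansion_order]; simp), ← hD]
        simp
      exact ⟨by exact_mod_cast h1, by exact_mod_cast h0⟩
    obtain ⟨D', rfl⟩ : PowerSeries.X ∣ D := PowerSeries.X_dvd_iff.mpr (by simpa using hD1.2)
    have hD' : D'.coeff 0 = 1 := by
      have := hD1.1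
      rwa [show 1 = 0 + 1 from rfl, PowerSeries.coeff_succ_X_mul] at this
    -- The discriminant is X times a series with constant term 1, so multiplying by it shifts the
    -- leading terms by one and frees degree 0 for e.
    refine ⟨d + 1, Fin.cons e fun j ↦ PowerSeries.X * D' * b j, by omega, ?_, ?_, ?_⟩
    · intro j
      refine Fin.cases ⟨by simpa using he0, by simp⟩ (fun j ↦ ?_) j
      simp only [Fin.cons_succ, Fin.val_succ, mul_assoc]
      obtain ⟨u, hu⟩ : PowerSeries.X ^ (j : ℕ) ∣ b j := PowerSeries.X_pow_dvd_iff.mpr (hb j).2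
      have hu0 : u.coeff 0 = 1 := by
        have := (hb j).1
        rwa [hu, PowerSeries.coeff_X_pow_mul', if_pos le_rfl, Nat.sub_self] at this
      rw [hu, show PowerSeries.X * (D' * (PowerSeries.X ^ (j : ℕ) * u)) =
        PowerSeries.X ^ ((j : ℕ) + 1) * (D' * u) by ring]
      constructor
      · rw [PowerSeries.coeff_X_pow_mul', if_pos le_rfl, Nat.sub_self]
        simpa using by simp at hD' hu0; rw [hD', hu0]; rfl
      · intro i hi
        rw [PowerSeries.coeff_X_pow_mul', if_neg (by omega)]
    · intro j
      refine Fin.cases ⟨E, hE, by simpa using hEe⟩ (fun j ↦ ?_) j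
      obtain ⟨F, hF, hFb⟩ := hbF j
      have hΔ : discriminant ∈ forms 𝒮ℒ 12 := ⟨(CuspForm.discriminant : ModularForm 𝒮ℒ 12), rfl⟩
      refine ⟨discriminant * F, mul_mem_forms hΔ hF (by omega), ?_⟩
      have hΔ' := forms_le_periodicFun one_mem_strictPeriods_SL hΔ
      have hF' := forms_le_periodicFun one_mem_strictPeriods_SL hF
      rw [Fin.cons_succ, map_mul, hD, ← hFb]
      exact map_mul qHom (⟨_, hΔ'⟩ : periodicFun) ⟨_, hF'⟩
    · rintro _ ⟨f, rfl⟩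
      obtain ⟨g, hg⟩ := hcusp f
      obtain ⟨x, hx⟩ := hspan g (by rw [hcast]; exact coe_mem_forms g)
      refine ⟨Fin.cons ((qExpansion 1 f).coeff 0) x, ?_⟩
      rw [Fin.sum_univ_succ, Fin.cons_zero, Fin.cons_zero]
      conv_lhs => rw [hg, hx, ← hD, Finset.mul_sum]
      congr 1
      refine Finset.sum_congr rfl fun j _ ↦ ?_
      rw [Fin.cons_succ, Fin.cons_succ, map_mul _ (PowerSeries.X * D'), mul_smul_comm]

end EisCongr

/-! ### Translates under SL₂(ℤ): characteristic polynomial and different. -/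

namespace EisCongr

open UpperHalfPlane ModularForm SlashInvariantForm
open scoped Manifold

section conj

variable {Γ : Subgroup (GL (Fin 2) ℝ)} [Γ.IsArithmetic] [Γ.HasDetOne]

variable (Γ) in
/-- The cosets of `Γ` in the full modular group. -/
abbrev Cosets : Type := 𝒮ℒ ⧸ Γ.subgroupOf 𝒮ℒ

noncomputable instance : Fintype (Cosets Γ) := Fintype.ofFinite _

variable (Γ) in
/-- The coset of the identity. -/
abbrev oneCoset : Cosets Γ := Quotient.mk _ 1

/-- The translates of a modular form under the full modular group. -/
noncomputable abbrev conj {k : ℤ} (f : ModularForm Γ k) (q : Cosets Γ) : ℍ → ℂ :=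
  quotientFunc (ℋ := 𝒮ℒ) f q

theorem conj_mul {k l m : ℤ} (hm : k + l = m) (f : ModularForm Γ k) (g : ModularForm Γ l)
    (u : ModularForm Γ m) (hu : ⇑u = f * g) (q : Cosets Γ) : conj u q = conj f q * conj g q := by
  subst hm
  induction q using Quotient.inductionOn with
  | h r =>
    have : |(r.val⁻¹).det.val| = 1 := Subgroup.HasDetPlusMinusOne.abs_det (inv_mem r.2)
    rw [conj, conj, conj, quotientFunc_mk, quotientFunc_mk, quotientFunc_mk, hu, mul_slash, this,
      one_smul]

theorem conj_pow {k : ℤ} (f : ModularForm Γ k) (n : ℕ) (q : Cosets Γ) :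
    conj (f.pow n) q = conj f q ^ n := by
  induction n with
  | zero =>
    induction q using Quotient.inductionOn with
    | h r =>
      obtain ⟨r, γ, rfl⟩ := r
      rw [conj, quotientFunc_mk, coe_pow, pow_zero, pow_zero]
      have h1 : (1 : ℍ → ℂ) ∣[(0 : ℤ)] (Matrix.SpecialLinearGroup.mapGL ℝ γ)⁻¹ = 1 := by
        rw [← map_inv]
        exact is_invariant_one γ⁻¹
      convert h1 using 2
      simp
  | succ n ih =>
    rw [pow_succ, ← ih]
    exact conj_mul (by push_cast; ring) (f.pow n) f (f.pow (n + 1))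
      (by rw [coe_pow, coe_pow, pow_succ]) q

theorem conj_oneCoset {k : ℤ} (f : ModularForm Γ k) : conj f (oneCoset Γ) = f := by
  rw [conj, quotientFunc_mk]
  simp

theorem mdifferentiable_conj {k : ℤ} (f : ModularForm Γ k) (q : Cosets Γ) : MDiff (conj f q) := by
  induction q using Quotient.inductionOn with
  | h r => exact (ModularForm.translate f r.val⁻¹).holo'

theorem sum_conj_mem_forms {k : ℤ} (f : ModularForm Γ k) : ∑ q, conj f q ∈ forms 𝒮ℒ k := by
  have := coe_mem_forms (ModularForm.trace 𝒮ℒ f)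
  rw [ModularForm.coe_trace] at this
  convert this

/-- Power sums of the translates of f are traces of powers of f, hence of level one; Newton's
identities pass to elementary symmetric functions, as n is invertible in ℂ. -/
theorem esymm_conj_mem_forms {k : ℤ} (f : ModularForm Γ k) (n : ℕ) :
    MvPolynomial.aeval (conj f) (MvPolynomial.esymm (Cosets Γ) ℂ n) ∈ forms 𝒮ℒ (n * k) := by
  induction n using Nat.strong_induction_on with
  | _ n ih =>
  rcases Nat.eq_zero_or_pos n with rfl | hn
  · rw [MvPolynomial.esymm_zero, map_one]
    exact one_mem_forms (by simp)
  have h := congrArg (MvPolynomial.aeval (conj f)) (MvPolynomial.mul_esymm_eq_sum (Cosets Γ) ℂ n)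
  rw [map_mul, map_mul, map_natCast, map_sum] at h
  have hsum : ∑ a ∈ (Finset.HasAntidiagonal.antidiagonal n).filter (fun a : ℕ × ℕ ↦ a.1 < n), MvPolynomial.aeval (conj f)
      ((-1) ^ a.1 * MvPolynomial.esymm (Cosets Γ) ℂ a.1 * MvPolynomial.psum (Cosets Γ) ℂ a.2) ∈
      forms 𝒮ℒ (n * k) := by
    refine Submodule.sum_mem _ fun a ha ↦ ?_
    rw [Finset.mem_filter, Finset.HasAntidiagonal.mem_antidiagonal] at ha
    have hp : MvPolynomial.aeval (conj f) (MvPolynomial.psum (Cosets Γ) ℂ a.2) ∈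
        forms 𝒮ℒ (a.2 * k) := by
      have := sum_conj_mem_forms (f.pow a.2)
      simp only [conj_pow] at this
      simpa [MvPolynomial.psum] using this
    have hep := mul_mem_forms (ih _ ha.2) hp (m := n * k) (by rw [← ha.1]; push_cast; ring)
    have := (forms 𝒮ℒ (n * k)).smul_mem ((-1) ^ a.1) hep
    convert this using 1
    rw [map_mul, map_mul, map_pow, map_neg, map_one, mul_assoc, Algebra.smul_def, map_pow, map_neg,
      map_one]
  have hn0 : (n : ℂ) ≠ 0 := by exact_mod_cast hn.ne'
  have := (forms 𝒮ℒ (n * k)).smul_mem ((n : ℂ)⁻¹ * (-1) ^ (n + 1)) hsum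
  convert this using 1
  rw [mul_smul, Algebra.smul_def ((-1 : ℂ) ^ (n + 1)), map_pow, map_neg, map_one]
  rw [map_pow, map_neg, map_one] at h
  rw [← h, eq_inv_smul_iff₀ hn0, Algebra.smul_def, map_natCast]

/-- The characteristic polynomial of a modular form over the forms of level one. -/
noncomputable def charpoly {k : ℤ} (f : ModularForm Γ k) : Polynomial (ℍ → ℂ) :=
  ∏ q : Cosets Γ, (Polynomial.X - Polynomial.C (conj f q))

theorem coeff_charpoly_mem_forms {k : ℤ} (f : ModularForm Γ k) {i : ℕ}
    (hi : i ≤ Fintype.card (Cosets Γ)) :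
    (charpoly f).coeff i ∈ forms 𝒮ℒ ((Fintype.card (Cosets Γ) - i : ℕ) * k) := by
  have h1 : charpoly f = ((Finset.univ.val.map (conj f)).map fun t ↦
      Polynomial.X - Polynomial.C t).prod := by
    rw [Multiset.map_map]
    rfl
  have hcard : Multiset.card (Finset.univ.val.map (conj f)) = Fintype.card (Cosets Γ) := by simp
  rw [h1, Multiset.prod_X_sub_C_coeff _ (by rwa [hcard]), hcard,
    ← MvPolynomial.aeval_esymm_eq_multiset_esymm (Cosets Γ) ℂ]
  have := (forms 𝒮ℒ _).smul_mem ((-1) ^ (Fintype.card (Cosets Γ) - i))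
    (esymm_conj_mem_forms f (Fintype.card (Cosets Γ) - i))
  rwa [Algebra.smul_def, map_pow, map_neg, map_one] at this

theorem charpoly_monic {k : ℤ} (f : ModularForm Γ k) : (charpoly f).Monic :=
  Polynomial.monic_prod_of_monic _ _ fun _ _ ↦ Polynomial.monic_X_sub_C _

theorem natDegree_charpoly {k : ℤ} (f : ModularForm Γ k) :
    (charpoly f).natDegree = Fintype.card (Cosets Γ) := by
  rw [charpoly, Polynomial.natDegree_prod_of_monic _ _ fun _ _ ↦ Polynomial.monic_X_sub_C _]
  simp

/-- Every modular form satisfies a monic equation over the forms of level one. -/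
theorem exists_levelOne_relation {k : ℤ} (f : ModularForm Γ k) : ∃ P : ℕ → ℍ → ℂ,
    P 0 = 1 ∧ (∀ i ≤ Fintype.card (Cosets Γ), P i ∈ forms 𝒮ℒ (i * k)) ∧
    ∑ i ∈ Finset.range (Fintype.card (Cosets Γ) + 1), P i * ⇑f ^ (Fintype.card (Cosets Γ) - i) = 0 := by
  -- Indices are reversed so that P i has weight ik; f is a root, being its own translate at the
  -- identity coset.
  refine ⟨fun i ↦ (charpoly f).coeff (Fintype.card (Cosets Γ) - i), ?_, fun i hi ↦ ?_, ?_⟩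
  · have := (charpoly_monic f).coeff_natDegree
    rwa [natDegree_charpoly] at this
  · have := coeff_charpoly_mem_forms f (Nat.sub_le (Fintype.card (Cosets Γ)) i)
    rwa [Nat.sub_sub_self hi] at this
  · have h0 : (charpoly f).eval ⇑f = 0 := by
      rw [charpoly, Polynomial.eval_prod]
      exact Finset.prod_eq_zero (Finset.mem_univ (oneCoset Γ)) (by rw [conj_oneCoset]; simp)
    rw [Polynomial.eval_eq_sum_range, natDegree_charpoly, ← Finset.sum_range_reflect] at h0
    rw [← h0]
    refine Finset.sum_congr rfl fun i hi ↦ ?_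
    rw [Finset.mem_range] at hi
    rw [show Fintype.card (Cosets Γ) + 1 - 1 - i = Fintype.card (Cosets Γ) - i by omega]

open Classical in
/-- The different of `h` over the forms of level one. -/
noncomputable def different {k : ℤ} (h : ModularForm Γ k) : ℍ → ℂ :=
  ∏ q ∈ Finset.univ.erase (oneCoset Γ), (⇑h - conj h q)

/-- Multiples of the different of `h` are polynomials in `h` with coefficients of level one. -/
theorem exists_mul_different_eq_sum {k l : ℤ} (h : ModularForm Γ l) (f : ModularForm Γ k) :
    ∃ c : ℕ → ℍ → ℂ,
      (∀ i < Fintype.card (Cosets Γ), c i ∈ forms 𝒮ℒ (k + (Fintype.card (Cosets Γ) - 1 - i : ℕ) * l)) ∧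
      ⇑f * different h = ∑ i ∈ Finset.range (Fintype.card (Cosets Γ)), c i * ⇑h ^ i := by
  classical
  set μ := Fintype.card (Cosets Γ) with hμ
  refine ⟨fun n ↦ ∑ i ∈ Finset.Icc (n + 1) μ,
    (∑ q, conj f q * conj h q ^ (i - (n + 1))) * (charpoly h).coeff i, fun n hn ↦ ?_, ?_⟩
  · refine Submodule.sum_mem _ fun i hi ↦ ?_
    rw [Finset.mem_Icc] at hi
    have htr : ∑ q, conj f q * conj h q ^ (i - (n + 1)) ∈
        forms 𝒮ℒ (k + (i - (n + 1) : ℕ) * l) := by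
      have := sum_conj_mem_forms (f.mul (h.pow (i - (n + 1))))
      convert this using 2 with q
      rw [← conj_pow]
      exact (conj_mul rfl f (h.pow (i - (n + 1))) _ (by simp) q).symm
    refine mul_mem_forms htr (coeff_charpoly_mem_forms h hi.2) ?_
    rw [← hμ, add_assoc, ← add_mul, ← Nat.cast_add]
    congr 3
    omega
  -- The product is the quotient of the characteristic polynomial by X - h_q, evaluated at h;
  -- synthetic division gives its coefficients as polynomials in h_q.
  · have hq : ∀ q : Cosets Γ, ∏ r ∈ Finset.univ.erase q, (⇑h - conj h r) =
        ∑ n ∈ Finset.range μ, (∑ i ∈ Finset.Icc (n + 1) μ,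
          conj h q ^ (i - (n + 1)) * (charpoly h).coeff i) * ⇑h ^ n := by
      intro q
      have hmul : charpoly h = (Polynomial.X - Polynomial.C (conj h q)) *
          ∏ r ∈ Finset.univ.erase q, (Polynomial.X - Polynomial.C (conj h r)) :=
        (Finset.mul_prod_erase _ _ (Finset.mem_univ q)).symm
      have hdiv : charpoly h /ₘ (Polynomial.X - Polynomial.C (conj h q)) =
          ∏ r ∈ Finset.univ.erase q, (Polynomial.X - Polynomial.C (conj h r)) := by
        rw [hmul, Polynomial.mul_divByMonic_cancel_left _ (Polynomial.monic_X_sub_C _)]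
      have hdeg : (∏ r ∈ Finset.univ.erase q, (Polynomial.X - Polynomial.C (conj h r))).natDegree <
          μ := by
        rw [Polynomial.natDegree_prod_of_monic _ _ fun q _ ↦ Polynomial.monic_X_sub_C _]
        have : 0 < Fintype.card (Cosets Γ) := Fintype.card_pos_iff.mpr ⟨q⟩
        simp [Finset.card_erase_of_mem]
        omega
      have heval := Polynomial.eval_eq_sum_range' hdeg (⇑h)
      rw [Polynomial.eval_prod] at heval
      simp only [Polynomial.eval_sub, Polynomial.eval_X, Polynomial.eval_C] at heval
      rw [heval]
      refine Finset.sum_congr rfl fun n _ ↦ ?_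
      rw [← hdiv, Polynomial.coeff_divByMonic_X_sub_C, natDegree_charpoly]
    -- Every term with q not the identity coset contains the factor h - h = 0. Summing over q makes
    -- the coefficients traces of f h^j times level one forms.
    have hsum : ∑ q, conj f q * ∏ r ∈ Finset.univ.erase q, (⇑h - conj h r) = ⇑f * different h := by
      rw [Finset.sum_eq_single (oneCoset Γ)]
      · rw [conj_oneCoset, different]
      · intro q _ hne
        rw [Finset.prod_eq_zero (Finset.mem_erase.mpr ⟨hne.symm, Finset.mem_univ _⟩)
          (by rw [conj_oneCoset, sub_self]), mul_zero]
      · simp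
    rw [← hsum]
    simp only [hq, Finset.mul_sum, Finset.sum_mul]
    rw [Finset.sum_comm]
    refine Finset.sum_congr rfl fun n _ ↦ ?_
    rw [Finset.sum_comm]
    refine Finset.sum_congr rfl fun i _ ↦ Finset.sum_congr rfl fun q _ ↦ ?_
    ring

theorem different_ne_zero {k : ℤ} (h : ModularForm Γ k)
    (hne : ∀ q : Cosets Γ, q ≠ oneCoset Γ → conj h q ≠ ⇑h) : different h ≠ 0 := by
  classical
  rw [different, Ne, UpperHalfPlane.prod_eq_zero_iff]
  · rintro ⟨q, hq, h0⟩
    exact hne q (Finset.mem_erase.mp hq).1 (sub_eq_zero.mp h0).symm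
  · exact fun q _ ↦ h.holo'.sub (mdifferentiable_conj h q)

end conj

end EisCongr

/-! ### The form E₄(Nτ) and its stabilizer. -/

namespace EisCongr

open UpperHalfPlane ModularForm SlashInvariantForm EisensteinSeries Matrix.SpecialLinearGroup
open scoped Manifold

/-- The first column is a gcd times a primitive vector, and a primitive vector is the first column
of some γ; then γ⁻¹ clears the lower entry. -/
theorem exists_eq_SL_mul_upperTriangular (M : Matrix (Fin 2) (Fin 2) ℤ) (hM : M.det ≠ 0) :
    ∃ (γ : SL(2, ℤ)) (U : Matrix (Fin 2) (Fin 2) ℤ), M = γ.1 * U ∧ U 1 0 = 0 := by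
  have hg : 0 < Int.gcd (M 0 0) (M 1 0) := by
    refine Int.gcd_pos_iff.mpr ?_
    by_contra! h
    rw [Matrix.det_fin_two, h.1, h.2] at hM
    simp at hM
  obtain ⟨x, y, hxy, hx, hy⟩ := Int.exists_gcd_one hg
  obtain ⟨γ, h0, h1⟩ := (Int.isCoprime_iff_gcd_eq_one.mpr hxy).exists_SL2_col 0
  refine ⟨γ, (γ⁻¹).1 * M, ?_, ?_⟩
  · rw [← mul_assoc, ← Matrix.SpecialLinearGroup.coe_mul, mul_inv_cancel]
    simp
  · rw [Matrix.SpecialLinearGroup.SL2_inv_expl, Matrix.mul_apply]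
    simp only [Fin.sum_univ_two, h0, h1, Matrix.cons_val_zero, Matrix.cons_val_one]
    simp
    linear_combination x * hy - y * hx

theorem coe_mapGL_int (γ : SL(2, ℤ)) : (mapGL ℝ γ).1 = γ.1.map (Int.castRingHom ℝ) := rfl

section raise

variable (N : ℕ) [NeZero N]

/-- The matrix `diag(N, 1)`. -/
noncomputable def diagGL : GL (Fin 2) ℝ :=
  Matrix.GeneralLinearGroup.mkOfDetNeZero !![(N : ℝ), 0; 0, 1]
    (by simp [Matrix.det_fin_two, NeZero.ne N])

theorem det_diagGL : (diagGL N).det.val = N := by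
  simp [diagGL, Matrix.GeneralLinearGroup.mkOfDetNeZero, Matrix.GeneralLinearGroup.det, Matrix.det_fin_two]

theorem coe_diagGL_smul (τ : ℍ) : ((diagGL N • τ : ℍ) : ℂ) = N * τ := by
  have hN : (0 : ℝ) < N := by exact_mod_cast Nat.pos_of_neZero N
  rw [coe_smul_of_det_pos (by rw [det_diagGL]; exact hN)]
  simp [num, denom, diagGL, Matrix.GeneralLinearGroup.mkOfDetNeZero]

theorem slash_diagGL (k : ℤ) (f : ℍ → ℂ) (τ : ℍ) :
    (f ∣[k] diagGL N) τ = f (diagGL N • τ) * (N : ℂ) ^ (k - 1) := by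
  have hN : (0 : ℝ) < N := by exact_mod_cast Nat.pos_of_neZero N
  have hσ : σ (diagGL N) = ContinuousAlgEquiv.refl ℝ ℂ := by
    rw [σ, det_diagGL, if_pos hN]
  rw [slash_apply, hσ, det_diagGL, abs_of_pos hN]
  simp [denom, diagGL, Matrix.GeneralLinearGroup.mkOfDetNeZero]

open ConjAct Pointwise in
theorem Gam0_le_conj_diagGL : Gam0 N ≤ toConjAct (diagGL N)⁻¹ • 𝒮ℒ := by
  rintro _ ⟨γ, hγ, rfl⟩
  rw [SetLike.mem_coe, Gamma0_mem, ZMod.intCast_zmod_eq_zero_iff_dvd] at hγ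
  obtain ⟨c, hc⟩ := hγ
  rw [Subgroup.mem_pointwise_smul_iff_inv_smul_mem, ← map_inv, inv_inv, toConjAct_smul]
  have hdet := γ.2
  rw [Matrix.det_fin_two] at hdet
  let γ' : SL(2, ℤ) := ⟨!![γ 0 0, N * γ 0 1; c, γ 1 1], by
    rw [Matrix.det_fin_two_of]
    rw [hc] at hdet
    linear_combination hdet⟩
  refine ⟨γ', ?_⟩
  rw [eq_mul_inv_iff_mul_eq]
  refine Units.ext ?_
  have hc' : ((γ 1 0 : ℤ) : ℝ) = N * c := by exact_mod_cast hc
  change (mapGL ℝ γ').1 * (diagGL N).1 = (diagGL N).1 * (mapGL ℝ γ).1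
  rw [coe_mapGL_int, coe_mapGL_int]
  ext i j
  fin_cases i <;> fin_cases j <;>
    simp [γ', diagGL, Matrix.GeneralLinearGroup.mkOfDetNeZero, Matrix.mul_apply, Fin.sum_univ_two,
      hc', mul_comm]

/-- The form `E₄(N τ)`. -/
theorem E₄_diagGL_mem_forms : (fun τ ↦ E₄ (diagGL N • τ)) ∈ forms (Gam0 N) 4 := by
  have h1 := forms_mono (Gam0_le_conj_diagGL N) 4 (coe_mem_forms (ModularForm.translate E₄ (diagGL N)))
  have := (forms (Gam0 N) 4).smul_mem ((N : ℂ) ^ (4 - 1 : ℤ))⁻¹ h1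
  convert this using 1
  ext τ
  have hN : (N : ℂ) ≠ 0 := NeZero.ne _
  rw [Pi.smul_apply, ModularForm.coe_translate, slash_diagGL, smul_eq_mul, mul_comm, mul_assoc,
    mul_inv_cancel₀ (zpow_ne_zero _ hN), mul_one]

theorem exists_int_qExpansion_E₄_diagGL : ∃ A : PowerSeries ℤ,
    A.map (Int.castRingHom ℂ) = qExpansion 1 (fun τ ↦ E₄ (diagGL N • τ)) := by
  obtain ⟨A, hA, -⟩ := exists_int_qExpansion_E₄
  obtain ⟨f, hf⟩ := E₄_diagGL_mem_forms N
  refine ⟨PowerSeries.mk fun n ↦ if N ∣ n then (1 + 240 * A).coeff (n / N) else 0, ?_⟩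
  rw [← hf]
  ext n
  rw [PowerSeries.coeff_map, PowerSeries.coeff_mk]
  refine ModularFormClass.qExpansion_coeff_unique (f := f)
    (c := fun n ↦ Int.castRingHom ℂ (if N ∣ n then (1 + 240 * A).coeff (n / N) else 0))
    one_pos (by simp) (fun τ ↦ ?_) n
  have h1 : HasSum _ (E₄ (diagGL N • τ)) := ModularForm.hasSum_qExpansion E₄ one_pos
    (by simp) (diagGL N • τ)
  rw [hf]
  have hinj : Function.Injective fun m : ℕ ↦ N * m := mul_right_injective₀ (NeZero.ne N)
  refine (Function.Injective.hasSum_iff hinj fun m hm ↦ ?_).mp ?_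
  · have : ¬ N ∣ m := fun ⟨c, hc⟩ ↦ hm ⟨c, hc.symm⟩
    simp [this]
  · convert h1 using 2 with m
    simp only [Function.comp, ← hA, PowerSeries.coeff_map, dvd_mul_right,
      if_true, Nat.mul_div_cancel_left m (Nat.pos_of_neZero N), Function.Periodic.qParam,
      coe_diagGL_smul, ← Complex.exp_nat_mul]
    congr 2
    push_cast
    ring

theorem tendsto_E₄ : Filter.Tendsto E₄ atImInfty (nhds 1) := by
  have h0 : cuspFunction 1 E₄ 0 = 1 := by
    obtain ⟨A, hA, hA'⟩ := exists_int_qExpansion_E₄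
    have := congrArg (PowerSeries.coeff 0) hA
    have hp := forms_le_periodicFun (by simp) (coe_mem_forms E₄)
    rw [qExpansion_coeff_zero one_pos (analyticAt_cuspFunction hp) (by exact_mod_cast hp.1),
      ← cuspFunction_apply_zero one_pos (analyticAt_cuspFunction hp) (by exact_mod_cast hp.1)] at this
    rw [← this, hA', PowerSeries.coeff_map, map_add, PowerSeries.coeff_zero_eq_constantCoeff,
      map_mul]
    simp [PowerSeries.constantCoeff_mk]
  have hc : ContinuousAt (cuspFunction 1 E₄) 0 :=
    (ModularFormClass.analyticAt_cuspFunction_zero E₄ one_pos (by simp)).continuousAt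
  have := (h0 ▸ hc.tendsto).comp (qParam_tendsto_atImInfty one_pos)
  refine this.congr fun τ ↦ ?_
  exact SlashInvariantFormClass.eq_cuspFunction E₄ τ (by simp) one_ne_zero

/-- Write diag(N,1)δ = γU with U upper triangular. As E₄ is γ-invariant, E₄|U = E₄|diag(N,1); the
limits at i∞ give U₁₁⁴ = 1. Since det U = N, N divides U₀₀, hence also the lower left entry γ₁₀U₀₀
of δ. -/
theorem mem_Gamma0_of_slash_eq (δ : SL(2, ℤ))
    (h : (⇑E₄ ∣[(4 : ℤ)] diagGL N) ∣[(4 : ℤ)] mapGL ℝ δ = ⇑E₄ ∣[(4 : ℤ)] diagGL N) : δ ∈ Gamma0 N := by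
  have hN : (N : ℂ) ≠ 0 := NeZero.ne _
  obtain ⟨γ, U, hγ, hU⟩ := exists_eq_SL_mul_upperTriangular (!![(N : ℤ), 0; 0, 1] * δ.1)
    (by rw [Matrix.det_mul, δ.2, Matrix.det_fin_two_of]; simp [NeZero.ne N])
  have hdet : U 0 0 * U 1 1 = N := by
    have := congrArg Matrix.det hγ
    rw [Matrix.det_mul, Matrix.det_mul, γ.2, δ.2, Matrix.det_fin_two_of, Matrix.det_fin_two, hU] at this
    linarith
  let V : GL (Fin 2) ℝ := (mapGL ℝ γ)⁻¹ * (diagGL N * mapGL ℝ δ)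
  have hV : V.1 = U.map (Int.castRingHom ℝ) := by
    have h2 : (diagGL N * mapGL ℝ δ).1 = (mapGL ℝ γ).1 * U.map (Int.castRingHom ℝ) := by
      have := congrArg (fun M ↦ M.map (Int.castRingHom ℝ)) hγ
      simp only [Matrix.map_mul] at this
      rw [coe_mapGL_int, ← this, Units.val_mul, coe_mapGL_int]
      congr 1
      ext i j
      fin_cases i <;> fin_cases j <;> simp [diagGL, Matrix.GeneralLinearGroup.mkOfDetNeZero]
    rw [Units.val_mul, h2, ← mul_assoc, ← Units.val_mul, inv_mul_cancel, Units.val_one, one_mul]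
  have hV10 : V 1 0 = 0 := by
    rw [hV]
    simp [hU]
  have hVdet : V.det.val = N := by
    rw [Matrix.GeneralLinearGroup.val_det_apply, hV, Matrix.det_fin_two]
    simp only [Matrix.map_apply, hU]
    simpa using congrArg (Int.cast : ℤ → ℝ) hdet
  have hslash : ⇑E₄ ∣[(4 : ℤ)] V = ⇑E₄ ∣[(4 : ℤ)] diagGL N := by
    rw [← h, ← SlashAction.slash_mul, show V = (mapGL ℝ γ)⁻¹ * (diagGL N * mapGL ℝ δ) from rfl,
      SlashAction.slash_mul _ (mapGL ℝ γ)⁻¹]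
    congr 1
    exact SlashInvariantFormClass.slash_action_eq E₄ _ (inv_mem ⟨γ, rfl⟩)
  have hNpos : (0 : ℝ) < N := by exact_mod_cast Nat.pos_of_neZero N
  have hσ : σ V = ContinuousAlgEquiv.refl ℝ ℂ := by
    rw [σ, hVdet, if_pos hNpos]
  have e1 : ∀ τ, (⇑E₄ ∣[(4 : ℤ)] V) τ = E₄ (V • τ) * ((N : ℂ) ^ (4 - 1 : ℤ) * (U 1 1 : ℂ) ^ (-4 : ℤ)) := by
    intro τ
    rw [slash_apply, hσ, hVdet, abs_of_pos hNpos, denom, hV10, hV]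
    simp [mul_assoc]
  have h10 : diagGL N 1 0 = 0 := by simp [diagGL, Matrix.GeneralLinearGroup.mkOfDetNeZero]
  have t1 := (tendsto_E₄.comp (tendsto_smul_atImInfty hV10)).mul_const
    ((N : ℂ) ^ (4 - 1 : ℤ) * (U 1 1 : ℂ) ^ (-4 : ℤ))
  have t2 := (tendsto_E₄.comp (tendsto_smul_atImInfty h10)).mul_const ((N : ℂ) ^ (4 - 1 : ℤ))
  have hlim := tendsto_nhds_unique t1 (t2.congr fun τ ↦ by
    rw [Function.comp, ← slash_diagGL, ← hslash, e1]; rfl)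
  have hU4 : (U 1 1) ^ 4 = 1 := by
    have : (U 1 1 : ℂ) ^ (-4 : ℤ) = 1 := by
      have hn := zpow_ne_zero (4 - 1 : ℤ) hN
      rw [one_mul, one_mul] at hlim
      exact mul_left_cancel₀ hn (by rw [hlim, mul_one])
    rw [zpow_neg, inv_eq_one] at this
    exact_mod_cast this
  have hunit : IsUnit (U 1 1) := IsUnit.of_pow_eq_one hU4 (by norm_num)
  rw [Gamma0_mem, ZMod.intCast_zmod_eq_zero_iff_dvd]
  have hdvd : (N : ℤ) ∣ U 0 0 := by
    rw [← hdet]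
    exact (hunit.mul_right_dvd).mpr dvd_rfl
  have := congrFun (congrFun hγ 1) 0
  simp [Matrix.mul_apply, Fin.sum_univ_two, hU] at this
  rw [this]
  exact hdvd.mul_left _

/-- The form `E₄(N τ)` of level `N`. -/
noncomputable def raisedE₄ : ModularForm (Gam0 N) 4 := (E₄_diagGL_mem_forms N).choose

theorem coe_raisedE₄ : ⇑(raisedE₄ N) = fun τ ↦ E₄ (diagGL N • τ) :=
  (E₄_diagGL_mem_forms N).choose_spec

/-- The stabilizer of E₄(Nτ) in SL₂(ℤ) lies in Γ₀(N), so its translates at the other cosets differ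
from it. This makes the different usable as a denominator. -/
theorem different_raisedE₄_ne_zero : different (raisedE₄ N) ≠ 0 := by
  have hN : (N : ℂ) ≠ 0 := NeZero.ne _
  refine different_ne_zero _ fun q hq heq ↦ hq ?_
  induction q using Quotient.inductionOn with
  | h r =>
  obtain ⟨_, γ, rfl⟩ := r
  have hE : ⇑E₄ ∣[(4 : ℤ)] diagGL N = (N : ℂ) ^ (4 - 1 : ℤ) • ⇑(raisedE₄ N) := by
    ext τ
    rw [slash_diagGL, coe_raisedE₄, Pi.smul_apply, smul_eq_mul, mul_comm]
  have hmem : γ⁻¹ ∈ Gamma0 N := by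
    refine mem_Gamma0_of_slash_eq N γ⁻¹ ?_
    rw [hE]
    change (_ • _) ∣[(4 : ℤ)] γ⁻¹ = _
    rw [SL_smul_slash, SL_slash, map_inv]
    exact congrArg _ heq
  refine (QuotientGroup.eq.mpr ?_).symm
  rw [inv_one, one_mul, Subgroup.mem_subgroupOf]
  exact ⟨γ, inv_mem_iff.mp hmem, rfl⟩

end raise

end EisCongr

/-! ### Quotients that are integral over level one are modular forms. -/

namespace EisCongr

open UpperHalfPlane ModularForm Filter Topology Matrix.SpecialLinearGroup
open scoped Manifold

/-- Cauchy's root bound. It turns integrality into boundedness, both near zeros of a denominator and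
at the cusps. -/
theorem norm_le_of_monic_relation {n : ℕ} {p : ℕ → ℂ} {x : ℂ} {C : ℝ} (hp : ∀ i ≤ n, ‖p i‖ ≤ C)
    (h0 : p 0 = 1) (h : ∑ i ∈ Finset.range (n + 1), p i * x ^ (n - i) = 0) : ‖x‖ ≤ 1 + n * C := by
  have hC : 0 ≤ C := (norm_nonneg _).trans (hp 0 n.zero_le)
  rcases n with _ | n
  · simp [h0] at h
  by_contra! hx
  have hx1 : 1 ≤ ‖x‖ := by
    have : 0 ≤ ((n + 1 : ℕ) : ℝ) * C := by positivity
    linarith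
  rw [Finset.sum_range_succ', h0, one_mul, Nat.sub_zero] at h
  have hle : ‖x‖ ^ (n + 1) ≤ (n + 1 : ℕ) * (C * ‖x‖ ^ n) := by
    rw [← norm_pow, eq_neg_of_add_eq_zero_right h, norm_neg]
    refine (norm_sum_le _ _).trans ((Finset.sum_le_card_nsmul _ _ (C * ‖x‖ ^ n) ?_).trans_eq ?_)
    · intro i hi
      rw [Finset.mem_range] at hi
      rw [norm_mul, norm_pow]
      exact mul_le_mul (hp _ (by omega)) (pow_le_pow_right₀ hx1 (by omega)) (by positivity) hC
    · simp
  have hpos : 0 < ‖x‖ ^ n := by positivity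
  rw [pow_succ', ← mul_assoc, mul_le_mul_iff_left₀ hpos] at hle
  linarith

/-- A quotient of holomorphic functions that satisfies a monic equation is holomorphic. -/
theorem exists_mdifferentiable_mul_eq {A G : ℍ → ℂ} (hA : MDiff A) (hG : MDiff G) (hG0 : G ≠ 0)
    (n : ℕ) (P : ℕ → ℍ → ℂ) (hP : ∀ i ≤ n, MDiff (P i)) (hP0 : P 0 = 1)
    (hrel : ∑ i ∈ Finset.range (n + 1), P i * G ^ i * A ^ (n - i) = 0) :
    ∃ F : ℍ → ℂ, MDiff F ∧ F * G = A := by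
  set q : ℂ → ℂ := fun z ↦ A (ofComplex z) / G (ofComplex z) with hq
  have hqd : ∀ z : ℍ, G z ≠ 0 → DifferentiableAt ℂ q z := fun z hz ↦ by
    refine DifferentiableAt.div (mdifferentiableAt_iff.mp (hA z)) (mdifferentiableAt_iff.mp (hG z)) ?_
    rwa [ofComplex_apply]
  -- The extension is the punctured limit of q at every point: it equals q where G is nonzero, and
  -- Riemann's theorem makes it holomorphic at the zeros of G.
  have hlim : ∀ z : ℍ, G z ≠ 0 → limUnder (𝓝[≠] (z : ℂ)) q = q z := fun z hz ↦
    ((hqd z hz).continuousAt.tendsto.mono_left nhdsWithin_le_nhds).limUnder_eq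
  have hFd : ∀ z : ℍ, DifferentiableAt ℂ (fun w ↦ limUnder (𝓝[≠] w) q) z := by
    intro z
    have hGne : ∀ᶠ w in 𝓝[≠] (z : ℂ), G (ofComplex w) ≠ 0 := by
      have hm : ∀ᶠ w in 𝓝[≠] z, G w ≠ 0 := by
        by_contra h
        exact hG0 (eq_zero_of_frequently hG (τ := z) (by
          rw [Filter.not_eventually] at h
          exact h.mono fun w hw ↦ not_not.mp hw))
      rw [eventually_nhdsWithin_iff] at hm ⊢
      rw [← isOpenEmbedding_coe.map_nhds_eq, eventually_map]
      filter_upwards [hm] with a ha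
      simpa using ha
    rw [eventually_nhdsWithin_iff] at hGne
    -- The summand 1 makes C strictly larger than each norm at z, so the bound persists nearby.
    set C : ℝ := ∑ i ∈ Finset.range (n + 1), (‖P i z‖ + 1) with hC
    have hPC : ∀ᶠ w in 𝓝 (z : ℂ), ∀ i ∈ Finset.range (n + 1), ‖P i (ofComplex w)‖ ≤ C := by
      rw [Filter.eventually_all_finset]
      intro i hi
      have hc : ContinuousAt (fun w ↦ ‖P i (ofComplex w)‖) (z : ℂ) :=
        (mdifferentiableAt_iff.mp (hP i (by simpa [Nat.lt_succ_iff] using hi) z)).continuousAt.norm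
      refine (hc.eventually_lt (continuousAt_const (y := C)) ?_).mono fun w hw ↦ hw.le
      rw [ofComplex_apply]
      refine (lt_add_one _).trans_le ?_
      exact Finset.single_le_sum (f := fun i ↦ ‖P i z‖ + 1) (fun j _ ↦ by positivity) hi
    have him : ∀ᶠ w in 𝓝 (z : ℂ), 0 < w.im :=
      (isOpen_lt continuous_const Complex.continuous_im).mem_nhds z.2
    set s : Set ℂ := {w | (w ∈ ({(z : ℂ)}ᶜ : Set ℂ) → G (ofComplex w) ≠ 0) ∧
      (∀ i ∈ Finset.range (n + 1), ‖P i (ofComplex w)‖ ≤ C) ∧ 0 < w.im} with hs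
    have hsn : s ∈ 𝓝 (z : ℂ) := hGne.and (hPC.and him)
    have hd : DifferentiableOn ℂ q (s \ {(z : ℂ)}) := by
      rintro w ⟨⟨h1, -, h3⟩, hw⟩
      have h1' := h1 hw
      rw [ofComplex_apply_of_im_pos h3] at h1'
      exact (hqd ⟨w, h3⟩ h1').differentiableWithinAt
    have hb : BddAbove (norm ∘ q '' (s \ {(z : ℂ)})) := by
      refine ⟨1 + n * C, ?_⟩
      rintro _ ⟨w, ⟨⟨h1, h2, -⟩, hw⟩, rfl⟩
      have h1' := h1 hw
      refine norm_le_of_monic_relation (p := fun i ↦ P i (ofComplex w))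
        (fun i hi ↦ h2 i (Finset.mem_range.mpr (by omega))) (by simp [hP0]) ?_
      have := congrFun hrel (ofComplex w)
      simp only [Finset.sum_apply, Pi.mul_apply, Pi.pow_apply, Pi.zero_apply] at this
      rw [← mul_eq_zero_iff_right (pow_ne_zero n h1'), Finset.sum_mul, ← this]
      refine Finset.sum_congr rfl fun i hi ↦ ?_
      rw [Finset.mem_range] at hi
      rw [hq, div_pow]
      have e : G (ofComplex w) ^ n = G (ofComplex w) ^ i * G (ofComplex w) ^ (n - i) := by
        rw [← pow_add]
        congr 1
        omega
      have := pow_ne_zero (n - i) h1'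
      rw [e]
      field_simp
    have hup := Complex.differentiableOn_update_limUnder_of_bddAbove hsn hd hb
    refine (hup.differentiableAt hsn).congr_of_eventuallyEq ?_
    filter_upwards [hsn] with w hw
    rcases eq_or_ne w z with rfl | hne
    · simp
    · rw [Function.update_of_ne hne]
      have h1 := hw.1 hne
      rw [ofComplex_apply_of_im_pos hw.2.2] at h1
      exact hlim ⟨w, hw.2.2⟩ h1
  have hF : MDiff fun z : ℍ ↦ limUnder (𝓝[≠] (z : ℂ)) q := by
    intro z
    rw [UpperHalfPlane.mdifferentiableAt_iff]
    refine (hFd z).congr_of_eventuallyEq ?_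
    filter_upwards [(isOpen_lt continuous_const Complex.continuous_im).mem_nhds z.2] with w hw
    simp only [Function.comp]
    rw [ofComplex_apply_of_im_pos hw]
  refine ⟨_, hF, ?_⟩
  have h0 : ((fun z : ℍ ↦ limUnder (𝓝[≠] (z : ℂ)) q) * G - A) * G = 0 := by
    ext z
    by_cases hz : G z = 0
    · simp [hz]
    · simp only [Pi.mul_apply, Pi.sub_apply, Pi.zero_apply]
      rw [hlim z hz]
      simp [hq, hz]
  exact sub_eq_zero.mp (((UpperHalfPlane.mul_eq_zero_iff ((hF.mul hG).sub hA) hG).mp h0).resolve_right hG0)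

/-- A function that satisfies a monic equation over the forms of level one is bounded at all cusps. -/
theorem isBoundedAtImInfty_slash_of_relation {k : ℤ} {F : ℍ → ℂ} (n : ℕ) (P : ℕ → ℍ → ℂ)
    (hP : ∀ i ≤ n, P i ∈ forms 𝒮ℒ (i * k)) (hP0 : P 0 = 1)
    (hrel : ∑ i ∈ Finset.range (n + 1), P i * F ^ (n - i) = 0) (γ : SL(2, ℤ)) :
    IsBoundedAtImInfty (F ∣[k] γ) := by
  have hb : ∀ i ∈ Finset.range (n + 1), ∃ M B : ℝ, ∀ z : ℍ, B ≤ z.im → ‖P i z‖ ≤ M := by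
    intro i hi
    obtain ⟨f, hf⟩ := hP i (by simpa [Nat.lt_succ_iff] using hi)
    rw [← hf]
    exact isBoundedAtImInfty_iff.mp (ModularFormClass.bdd_at_infty f)
  choose! M B hMB using hb
  rw [isBoundedAtImInfty_iff]
  refine ⟨1 + n * ∑ i ∈ Finset.range (n + 1), |M i|, ∑ i ∈ Finset.range (n + 1), |B i|, fun z hz ↦ ?_⟩
  refine norm_le_of_monic_relation (p := fun i ↦ P i z) (fun i hi ↦ ?_) (by simp [hP0]) ?_
  · have hi' : i ∈ Finset.range (n + 1) := Finset.mem_range.mpr (by omega)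
    refine (hMB i hi' z ?_).trans ((le_abs_self _).trans
      (Finset.single_le_sum (f := fun i ↦ |M i|) (fun j _ ↦ abs_nonneg _) hi'))
    exact ((le_abs_self _).trans
      (Finset.single_le_sum (f := fun i ↦ |B i|) (fun j _ ↦ abs_nonneg _) hi')).trans hz
  -- P i has weight ik, so dividing the relation at γz by the nk-th power of the automorphy factor
  -- gives the same relation at z for F|γ.
  · have := congrFun hrel (γ • z)
    simp only [Finset.sum_apply, Pi.mul_apply, Pi.pow_apply, Pi.zero_apply] at this
    set j := denom (toGL ((Matrix.SpecialLinearGroup.map (Int.castRingHom ℝ)) γ)) (z : ℂ) with hj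
    have hj0 : j ≠ 0 := denom_ne_zero _ _
    rw [← mul_eq_zero_iff_right (zpow_ne_zero (n * k) hj0), Finset.sum_mul, ← this]
    refine Finset.sum_congr rfl fun i hi ↦ ?_
    obtain ⟨f, hf⟩ := hP i (by simpa [Nat.lt_succ_iff] using hi)
    rw [Finset.mem_range] at hi
    have hPi : P i (γ • z) = j ^ (i * k) * P i z := by
      rw [← hf]
      exact SlashInvariantForm.slash_action_eqn'' (Γ := 𝒮ℒ) f (γ := mapGL ℝ γ) ⟨γ, rfl⟩ z
    rw [hPi, SL_slash_apply, ← hj, mul_pow, ← zpow_natCast (j ^ (-k)), ← zpow_mul,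
      show (n : ℤ) * k = i * k + (n - i : ℕ) * k by rw [← add_mul, ← Nat.cast_add]; congr 3; omega,
      zpow_add₀ hj0, show -k * ((n - i : ℕ) : ℤ) = -(((n - i : ℕ) : ℤ) * k) by ring, zpow_neg]
    have := zpow_ne_zero (((n - i : ℕ) : ℤ) * k) hj0
    field_simp

/-- A quotient of modular forms is a modular form if it is integral over the forms of level one. -/
theorem exists_mem_forms_mul_eq {Γ : Subgroup (GL (Fin 2) ℝ)} [Γ.IsArithmetic] [Γ.HasDetOne]
    {a b k : ℤ} (hab : k + b = a) {A G : ℍ → ℂ} (hA : A ∈ forms Γ a) (hG : G ∈ forms Γ b)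
    (hG0 : G ≠ 0) (n : ℕ) (P : ℕ → ℍ → ℂ) (hP : ∀ i ≤ n, P i ∈ forms 𝒮ℒ (i * k)) (hP0 : P 0 = 1)
    (hrel : ∑ i ∈ Finset.range (n + 1), P i * G ^ i * A ^ (n - i) = 0) :
    ∃ F ∈ forms Γ k, F * G = A := by
  have hmd : ∀ {Γ : Subgroup (GL (Fin 2) ℝ)} [Γ.HasDetOne] {k : ℤ} {F : ℍ → ℂ}, F ∈ forms Γ k →
      MDiff F := by
    rintro Γ _ k _ ⟨f, rfl⟩
    exact f.holo'
  obtain ⟨F, hF, rfl⟩ := exists_mdifferentiable_mul_eq (hmd hA) (hmd hG) hG0 n P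
    (fun i hi ↦ hmd (hP i hi)) hP0 hrel
  have hcancel : ∀ F' : ℍ → ℂ, MDiff F' → F' * G = 0 → F' = 0 := fun F' hF' h ↦
    ((UpperHalfPlane.mul_eq_zero_iff hF' (hmd hG)).mp h).resolve_right hG0
  have hrel' : ∑ i ∈ Finset.range (n + 1), P i * F ^ (n - i) = 0 := by
    have hs : MDiff (∑ i ∈ Finset.range (n + 1), P i * F ^ (n - i)) :=
      MDifferentiable.sum fun i hi ↦
        (hmd (hP i (by simpa [Nat.lt_succ_iff] using hi))).mul (hF.pow _)
    have hpow : ∀ m, MDiff (G ^ m) := fun m ↦ (hmd hG).pow m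
    refine ((UpperHalfPlane.mul_eq_zero_iff hs (hpow n)).mp ?_).resolve_right ?_
    · rw [← hrel, Finset.sum_mul]
      refine Finset.sum_congr rfl fun i hi ↦ ?_
      rw [Finset.mem_range] at hi
      rw [show n = i + (n - i) by omega, pow_add, mul_pow, Nat.add_sub_cancel_left]
      ring
    · intro h
      obtain ⟨z, hz⟩ := Function.ne_iff.mp hG0
      exact hz (eq_zero_of_pow_eq_zero (congrFun h z))
  refine ⟨F, ⟨{ toFun := F, slash_action_eq' := fun γ hγ ↦ ?_, holo' := hF,
                bdd_at_cusps' := fun {c} hc ↦ ?_ }, rfl⟩, rfl⟩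
  · obtain ⟨f, hf⟩ := hA
    obtain ⟨g, hg⟩ := hG
    have h1 : (F * G) ∣[k + b] γ = F * G := by
      rw [hab, ← hf]
      exact SlashInvariantFormClass.slash_action_eq f γ hγ
    have h2 : G ∣[b] γ = G := by
      rw [← hg]
      exact SlashInvariantFormClass.slash_action_eq g γ hγ
    rw [mul_slash, Subgroup.HasDetPlusMinusOne.abs_det hγ, one_smul, h2] at h1
    exact sub_eq_zero.mp (hcancel _ ((hF.slash k γ).sub hF) (by rw [sub_mul, h1, sub_self]))
  · rw [Subgroup.IsArithmetic.isCusp_iff_isCusp_SL2Z] at hc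
    rw [OnePoint.isBoundedAt_iff_forall_SL2Z hc]
    exact fun γ _ ↦ isBoundedAtImInfty_slash_of_relation n P hP hP0 hrel' γ

end EisCongr

/-! ### The index of Γ₀(N) for squarefree N. -/

namespace EisCongr

open Matrix.SpecialLinearGroup

section index

variable {t : ℕ} (p : Fin t → ℕ)

/-- The point of the projective line over `ℤ/p` given by the first column of a matrix. -/
noncomputable def columnPoint (p : ℕ) (γ : SL(2, ℤ)) : Option (ZMod p) :=
  if (γ 1 0 : ZMod p) = 0 then none else some ((γ 0 0 : ZMod p) * (γ 1 0 : ZMod p)⁻¹)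

/-- The entry is, up to sign, the determinant of the two first columns, which are proportional
modulo p. -/
theorem dvd_of_columnPoint_eq {p : ℕ} (hp : p.Prime) {γ δ : SL(2, ℤ)}
    (h : columnPoint p γ = columnPoint p δ) : (p : ℤ) ∣ (γ⁻¹ * δ) 1 0 := by
  have : Fact p.Prime := ⟨hp⟩
  have e : (γ⁻¹ * δ) 1 0 = γ 0 0 * δ 1 0 - γ 1 0 * δ 0 0 := by
    rw [Matrix.SpecialLinearGroup.coe_mul, Matrix.SpecialLinearGroup.SL2_inv_expl, Matrix.mul_apply]
    simp [Fin.sum_univ_two]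
    ring
  rw [e, ← ZMod.intCast_zmod_eq_zero_iff_dvd]
  push_cast
  simp only [columnPoint] at h
  split_ifs at h with h1 h2 h2
  · simp [h1, h2]
  · rw [Option.some_inj, ← div_eq_mul_inv, ← div_eq_mul_inv, div_eq_div_iff h1 h2] at h
    linear_combination h

/-- First columns modulo the p_i embed the cosets into a product of projective lines. Distinctness
of the primes lets divisibility by each p_i combine to divisibility by N. -/
theorem card_cosets_Gam0_le (hp : ∀ i, (p i).Prime) (hinj : Function.Injective p)
    [NeZero (∏ i, p i)] :
    Fintype.card (Cosets (Gam0 (∏ i, p i))) ≤ ∏ i, (p i + 1) := by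
  have : ∀ i, NeZero (p i) := fun i ↦ ⟨(hp i).ne_zero⟩
  have hrep : ∀ q : Cosets (Gam0 (∏ i, p i)), ∃ γ : SL(2, ℤ), mapGL ℝ γ = (q.out : 𝒮ℒ) :=
    fun q ↦ q.out.2
  choose γ hγ using hrep
  have hφ : Function.Injective fun q ↦ (fun i ↦ columnPoint (p i) (γ q) : ∀ i, Option (ZMod (p i))) := by
    intro q q' h
    have hdvd : ∀ i ∈ Finset.univ, (p i : ℤ) ∣ ((γ q)⁻¹ * γ q') 1 0 := fun i _ ↦
      dvd_of_columnPoint_eq (hp i) (congrFun h i)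
    have hN := Finset.prod_dvd_of_coprime (fun i _ j _ hij ↦ Nat.isCoprime_iff_coprime.mpr
      ((Nat.coprime_primes (hp i) (hp j)).mpr (hinj.ne hij))) hdvd
    rw [← Quotient.out_eq q, ← Quotient.out_eq q']
    refine QuotientGroup.eq.mpr ?_
    rw [Subgroup.mem_subgroupOf]
    refine ⟨(γ q)⁻¹ * γ q', ?_, ?_⟩
    · rw [SetLike.mem_coe, Gamma0_mem, ZMod.intCast_zmod_eq_zero_iff_dvd]
      exact_mod_cast hN
    · rw [map_mul, map_inv, hγ, hγ]
      rfl
  refine (Fintype.card_le_of_injective _ hφ).trans_eq ?_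
  simp [ZMod.card]

end index

end EisCongr

/-! ### Descent from ℂ to ℚ, and integrality by reduction modulo primes. -/

namespace PowerSeries

/-- Apply a linear map to the coefficients of a power series. -/
noncomputable def mapLin (φ : ℂ →ₗ[ℚ] ℚ) : PowerSeries ℂ →ₗ[ℚ] PowerSeries ℚ where
  toFun f := mk fun n ↦ φ (coeff n f)
  map_add' f g := by ext n; simp
  map_smul' c f := by ext n; simp

theorem coeff_mapLin (φ : ℂ →ₗ[ℚ] ℚ) (f : PowerSeries ℂ) (n : ℕ) :
    coeff n (mapLin φ f) = φ (coeff n f) := by simp [mapLin]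

/-- A ℚ-linear functional respects multiplication by rational series, so a relation for a rational
series descends to ℚ even when its coefficients are not rational. -/
theorem mapLin_mul_map (φ : ℂ →ₗ[ℚ] ℚ) (f : PowerSeries ℂ) (r : PowerSeries ℚ) :
    mapLin φ (f * r.map (algebraMap ℚ ℂ)) = mapLin φ f * r := by
  ext n
  rw [coeff_mapLin, coeff_mul, coeff_mul, map_sum]
  refine Finset.sum_congr rfl fun a _ ↦ ?_
  rw [coeff_map, coeff_mapLin, mul_comm, ← Algebra.smul_def, map_smul, smul_eq_mul, mul_comm]

theorem mapLin_smul_map_int (φ : ℂ →ₗ[ℚ] ℚ) (x : ℂ) (b : PowerSeries ℤ) :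
    mapLin φ (x • b.map (Int.castRingHom ℂ)) = φ x • b.map (Int.castRingHom ℚ) := by
  have : b.map (Int.castRingHom ℂ) = (b.map (Int.castRingHom ℚ)).map (algebraMap ℚ ℂ) := by
    ext n
    simp
  rw [this, smul_eq_C_mul, mapLin_mul_map, smul_eq_C_mul]
  congr 1
  ext n
  rw [coeff_mapLin, coeff_C, coeff_C]
  split_ifs <;> simp

theorem mapLin_one {φ : ℂ →ₗ[ℚ] ℚ} (hφ : φ 1 = 1) : mapLin φ 1 = 1 := by
  ext n
  rw [coeff_mapLin, coeff_one, coeff_one]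
  split_ifs <;> simp [hφ]

/-- Let D be the least denominator and s = D r. If a prime p divides D, then s mod p is divisible by
X^m and satisfies a nontrivial relation, so it is 0 and D/p is a smaller denominator. -/
theorem exists_int_coeff_of_relation {m n : ℕ} {d : ℕ → ℕ} (b : ∀ i, Fin (d i) → PowerSeries ℤ)
    (hb : ∀ i, EisCongr.IsUnitriangular (b i)) (hd : ∀ i ≤ n, d i ≤ m) (x : ∀ i, Fin (d i) → ℚ)
    (hx : ∃ i ≤ n, x i ≠ 0) {r : PowerSeries ℚ}
    (hrel : ∑ i ∈ Finset.range (n + 1),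
      (∑ j, x i j • (b i j).map (Int.castRingHom ℚ)) * r ^ (n - i) = 0)
    (hr : r ∈ bddDenom) (hint : ∀ i < m, ∃ z : ℤ, (z : ℚ) = coeff i r) (i : ℕ) :
    ∃ z : ℤ, (z : ℚ) = coeff i r := by
  have hex : ∃ D : ℕ, 0 < D ∧ ∃ s : PowerSeries ℤ, ∀ i, ((coeff i s : ℤ) : ℚ) = D * coeff i r := by
    obtain ⟨D, hD, s, hs⟩ := hr
    refine ⟨D.natAbs, Int.natAbs_pos.mpr hD, D.sign • s, fun i ↦ ?_⟩
    have := congrArg (coeff i) hs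
    rw [algebraMap_apply'', coeff_map, ← zsmul_eq_mul, map_zsmul, zsmul_eq_mul, eq_intCast] at this
    rw [map_zsmul, smul_eq_mul, Int.cast_mul, this, ← mul_assoc]
    congr 1
    rw [← Int.cast_mul, Int.sign_mul_self_eq_natAbs]
    simp
  classical
  obtain ⟨hD, s, hs⟩ := Nat.find_spec hex
  set D := Nat.find hex with hDdef
  have hD0 : (D : ℚ) ≠ 0 := by exact_mod_cast hD.ne'
  suffices D = 1 from ⟨coeff i s, by rw [hs, this, Nat.cast_one, one_mul]⟩
  by_contra hD1
  obtain ⟨p, hp, hpD⟩ := Nat.exists_prime_and_dvd hD1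
  have : Fact p.Prime := ⟨hp⟩
  have hs0 : s.map (Int.castRingHom (ZMod p)) = 0 := by
    obtain ⟨Z, hZ, hZrel⟩ : ∃ Z : ∀ i, Fin (d i) → ℤ,
        (∃ i ≤ n, ∃ j, ¬ (p : ℤ) ∣ Z i j) ∧ ∑ i ∈ Finset.range (n + 1),
          (∑ j, Z i j • b i j) * s ^ (n - i) = 0 := by
      -- Multiplying by D^n turns the relation for r into one for s with coordinates D^i x_i.
      -- Clearing their denominators and dividing by the gcd leaves some coordinate prime to p.
      set S : Finset (Σ i, Fin (d i)) := (Finset.range (n + 1)).sigma fun _ ↦ Finset.univ with hS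
      obtain ⟨c, hc⟩ := IsLocalization.exist_integer_multiples (nonZeroDivisors ℤ) S
        fun a ↦ (D : ℚ) ^ a.1 * x a.1 a.2
      have hc0 : ((c : ℤ) : ℚ) ≠ 0 := by exact_mod_cast nonZeroDivisors.coe_ne_zero c
      choose! w hw using hc
      obtain ⟨i₀, hi₀, hx₀⟩ := hx
      obtain ⟨j₀, hj₀⟩ := Function.ne_iff.mp hx₀
      have hmem : ⟨i₀, j₀⟩ ∈ S := by simp [hS]; omega
      obtain ⟨g, hg, hg1⟩ := Finset.extract_gcd w ⟨_, hmem⟩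
      have hw' : ∀ a ∈ S, (w a : ℚ) = c * ((D : ℚ) ^ a.1 * x a.1 a.2) := fun a ha ↦ by
        simpa using hw a ha
      have hgcd : S.gcd w ≠ 0 := fun h ↦ by
        have h0 := hw' _ hmem
        rw [Finset.gcd_eq_zero_iff.mp h _ hmem, Int.cast_zero] at h0
        exact mul_ne_zero hc0 (mul_ne_zero (pow_ne_zero _ hD0) hj₀) h0.symm
      refine ⟨fun i j ↦ g ⟨i, j⟩, ?_, ?_⟩
      · by_contra! h
        refine (Nat.prime_iff_prime_int.mp hp).not_dvd_one ?_
        rw [← hg1]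
        exact Finset.dvd_gcd fun a ha ↦ h a.1 (by simp [hS] at ha; omega) a.2
      · have hmap : Function.Injective (map (Int.castRingHom ℚ)) :=
          map_injective _ Int.cast_injective
        have hgQ : ((S.gcd w : ℤ) : ℚ) ≠ 0 := by exact_mod_cast hgcd
        apply hmap
        rw [map_zero]
        have hs' : s.map (Int.castRingHom ℚ) = (D : ℚ) • r := by
          ext i
          simpa using hs i
        have hkey : ((S.gcd w : ℤ) : ℚ) • map (Int.castRingHom ℚ) (∑ i ∈ Finset.range (n + 1),
            (∑ j, g ⟨i, j⟩ • b i j) * s ^ (n - i)) = ((c : ℤ) * (D : ℚ) ^ n) •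
            ∑ i ∈ Finset.range (n + 1),
              (∑ j, x i j • (b i j).map (Int.castRingHom ℚ)) * r ^ (n - i) := by
          rw [map_sum, Finset.smul_sum, Finset.smul_sum]
          refine Finset.sum_congr rfl fun i hi ↦ ?_
          have hin : i ≤ n := by simpa [Nat.lt_succ_iff] using hi
          rw [map_mul, map_pow, map_sum, hs', smul_pow, ← smul_mul_assoc, mul_smul_comm,
            ← smul_mul_assoc, ← smul_mul_assoc]
          congr 1
          rw [Finset.smul_sum, Finset.smul_sum, Finset.smul_sum]
          refine Finset.sum_congr rfl fun j _ ↦ ?_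
          have hm : (⟨i, j⟩ : Σ i, Fin (d i)) ∈ S := by simp [hS]; omega
          have h1 := hw' _ hm
          rw [hg _ hm, Int.cast_mul] at h1
          rw [zsmul_eq_mul, map_mul, map_intCast, ← zsmul_eq_mul, ← Int.cast_smul_eq_zsmul ℚ,
            smul_smul, smul_smul, smul_smul]
          congr 1
          rw [show (D : ℚ) ^ n = D ^ (n - i) * D ^ i by rw [← pow_add]; congr 1; omega]
          linear_combination (D : ℚ) ^ (n - i) * h1
        rw [hrel, smul_zero] at hkey
        exact (smul_eq_zero.mp hkey).resolve_left hgQ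
    refine eq_zero_of_X_pow_dvd_of_relation (m := m) ?_ n
      (fun i ↦ ∑ j, (Z i j : ZMod p) • (b i j).map (Int.castRingHom (ZMod p))) (fun i hi h ↦ ?_) ?_ ?_
    · rw [X_pow_dvd_iff]
      intro i hi
      obtain ⟨z, hz⟩ := hint i hi
      have := hs i
      rw [← hz] at this
      have h' : coeff i s = D * z := by exact_mod_cast this
      rw [coeff_map, h', eq_intCast, ZMod.intCast_zmod_eq_zero_iff_dvd]
      exact (Int.natCast_dvd_natCast.mpr hpD).mul_right z
    · have := (hb i).eq_zero (R := ZMod p) (fun j ↦ (Z i j : ZMod p)) (hd i hi) h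
      exact Finset.sum_eq_zero fun j _ ↦ by rw [congrFun this j, Pi.zero_apply, zero_smul]
    · obtain ⟨i, hi, j, hj⟩ := hZ
      refine ⟨i, hi, fun h ↦ hj ?_⟩
      have := (hb i).eq_zero (R := ZMod p) (m := m) (fun j ↦ (Z i j : ZMod p)) (hd i hi)
        (by rw [h]; exact dvd_zero _)
      exact (ZMod.intCast_zmod_eq_zero_iff_dvd _ _).mp (congrFun this j)
    · have := congrArg (map (Int.castRingHom (ZMod p))) hZrel
      rw [map_sum, map_zero] at this
      rw [← this]
      refine Finset.sum_congr rfl fun i _ ↦ ?_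
      rw [map_mul, map_pow, map_sum]
      congr 1
      refine Finset.sum_congr rfl fun j _ ↦ ?_
      rw [zsmul_eq_mul, map_mul, map_intCast, Int.cast_smul_eq_zsmul, zsmul_eq_mul]
  obtain ⟨D', hD'⟩ := hpD
  have hD'0 : 0 < D' := Nat.pos_of_ne_zero fun h ↦ by simp [h] at hD'; omega
  have hlt : D' < D := by
    rw [hD']
    exact lt_mul_of_one_lt_left hD'0 hp.one_lt
  refine Nat.find_min hex hlt ⟨hD'0, ?_⟩
  have hdvd : ∀ i, (p : ℤ) ∣ coeff i s := fun i ↦ by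
    have := congrArg (coeff i) hs0
    rwa [coeff_map, map_zero, eq_intCast, ZMod.intCast_zmod_eq_zero_iff_dvd] at this
  choose u hu using hdvd
  refine ⟨mk u, fun i ↦ ?_⟩
  have hp0 : (p : ℚ) ≠ 0 := by exact_mod_cast hp.ne_zero
  have := hs i
  rw [hu, hD'] at this
  push_cast at this
  rw [coeff_mk]
  exact mul_left_cancel₀ hp0 (by rw [this, mul_assoc])

end PowerSeries

/-! ### Galois stability, vanishing and integrality in level N. -/

namespace EisCongr

open UpperHalfPlane PowerSeries

section qExpansion

variable {F G : ℍ → ℂ}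

theorem qExpansion_mul_of_mem (hF : F ∈ periodicFun) (hG : G ∈ periodicFun) :
    qExpansion 1 (F * G) = qExpansion 1 F * qExpansion 1 G :=
  qExpansion_mul (analyticAt_cuspFunction hF) (analyticAt_cuspFunction hG)

theorem qExpansion_pow_of_mem (hF : F ∈ periodicFun) (n : ℕ) :
    qExpansion 1 (F ^ n) = qExpansion 1 F ^ n := by
  induction n with
  | zero => rw [pow_zero, pow_zero, qExpansion_one]
  | succ n ih => rw [pow_succ, pow_succ, qExpansion_mul_of_mem (pow_mem hF n) hF, ih]

theorem qExpansion_smul_of_mem (c : ℂ) (hF : F ∈ periodicFun) :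
    qExpansion 1 (c • F) = c • qExpansion 1 F :=
  qExpansion_smul (analyticAt_cuspFunction hF) c

theorem qExpansion_sum_of_mem {ι : Type*} (s : Finset ι) {F : ι → ℍ → ℂ}
    (hF : ∀ i ∈ s, F i ∈ periodicFun) :
    qExpansion 1 (∑ i ∈ s, F i) = ∑ i ∈ s, qExpansion 1 (F i) := by
  classical
  induction s using Finset.induction_on with
  | empty => rw [Finset.sum_empty, Finset.sum_empty, qExpansion_zero]
  | insert a s ha ih =>
    rw [Finset.sum_insert ha, Finset.sum_insert ha, ← ih fun i hi ↦ hF i (Finset.mem_insert_of_mem hi)]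
    exact qExpansion_add (analyticAt_cuspFunction (hF a (Finset.mem_insert_self a s)))
      (analyticAt_cuspFunction (sum_mem fun i hi ↦ hF i (Finset.mem_insert_of_mem hi)))

theorem eq_of_qExpansion_eq (hF : F ∈ periodicFun) (hG : G ∈ periodicFun)
    (h : qExpansion 1 F = qExpansion 1 G) : F = G :=
  congrArg Subtype.val (@qHom_injective ⟨F, hF⟩ ⟨G, hG⟩ h)

end qExpansion

section levelOne

theorem mem_periodicFun_of_levelOne {k : ℤ} {F : ℍ → ℂ} (hF : F ∈ forms 𝒮ℒ k) :
    F ∈ periodicFun :=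
  forms_le_periodicFun (by simp) hF

theorem exists_levelOne_qExpansion_eq_map (σ : ℂ →+* ℂ) {k : ℤ} {F : ℍ → ℂ} (w : ℕ) (hk : k = w)
    (hF : F ∈ forms 𝒮ℒ k) :
    ∃ F' ∈ forms 𝒮ℒ k, qExpansion 1 F' = (qExpansion 1 F).map σ := by
  subst hk
  obtain ⟨d, b, -, -, hb, hspan⟩ := exists_levelOne_basis w
  choose B hB hBq using hb
  obtain ⟨x, hx⟩ := hspan F hF
  have hmem : ∀ j, σ (x j) • B j ∈ forms 𝒮ℒ w := fun j ↦ (forms 𝒮ℒ w).smul_mem _ (hB j)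
  refine ⟨∑ j, σ (x j) • B j, sum_mem fun j _ ↦ hmem j, ?_⟩
  rw [qExpansion_sum_of_mem _ fun j _ ↦ mem_periodicFun_of_levelOne (hmem j), hx, map_sum]
  refine Finset.sum_congr rfl fun j _ ↦ ?_
  rw [qExpansion_smul_of_mem _ (mem_periodicFun_of_levelOne (hB j)), hBq]
  ext n
  simp

theorem mapLin_qExpansion_levelOne_mem (φ : ℂ →ₗ[ℚ] ℚ) {k : ℤ} {F : ℍ → ℂ} (w : ℕ) (hk : k = w)
    (hF : F ∈ forms 𝒮ℒ k) : mapLin φ (qExpansion 1 F) ∈ bddDenom := by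
  subst hk
  obtain ⟨d, b, -, -, -, hspan⟩ := exists_levelOne_basis w
  obtain ⟨x, hx⟩ := hspan F hF
  rw [hx, map_sum]
  refine sum_mem fun j _ ↦ ?_
  rw [mapLin_smul_map_int]
  exact bddDenom.smul_mem (map_mem_bddDenom _) _

end levelOne

section Gam0

variable {N : ℕ} [NeZero N]

local notation "μ" => Fintype.card (Cosets (Gam0 N))

theorem mem_periodicFun_of_Gam0 {k : ℤ} {F : ℍ → ℂ} (hF : F ∈ forms (Gam0 N) k) :
    F ∈ periodicFun :=
  forms_le_periodicFun (by simp) hF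

theorem levelOne_le_forms_Gam0 (k : ℤ) : forms 𝒮ℒ k ≤ forms (Gam0 N) k :=
  forms_mono (Subgroup.map_le_range _ _) k

theorem exists_int_qExpansion_raisedE₄ : ∃ A : PowerSeries ℤ,
    A.map (Int.castRingHom ℂ) = qExpansion 1 (raisedE₄ N) := by
  rw [coe_raisedE₄]
  exact exists_int_qExpansion_E₄_diagGL N

variable {k : ℕ} {c : ℕ → ℍ → ℂ}

theorem sum_mul_raisedE₄_mem_forms
    (hc : ∀ i < μ, c i ∈ forms 𝒮ℒ (k + (μ - 1 - i : ℕ) * 4)) :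
    ∑ i ∈ Finset.range μ, c i * ⇑(raisedE₄ N) ^ i ∈ forms (Gam0 N) (k + (μ - 1 : ℕ) * 4) := by
  refine sum_mem fun i hi ↦ ?_
  rw [Finset.mem_range] at hi
  refine mul_mem_forms (levelOne_le_forms_Gam0 _ (hc i hi))
    (pow_mem_forms (coe_mem_forms (raisedE₄ N)) i rfl) ?_
  rw [add_assoc, ← add_mul, ← Nat.cast_add]
  congr 3
  omega

theorem qExpansion_sum_mul_raisedE₄
    (hc : ∀ i < μ, c i ∈ forms 𝒮ℒ (k + (μ - 1 - i : ℕ) * 4)) :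
    qExpansion 1 (∑ i ∈ Finset.range μ, c i * ⇑(raisedE₄ N) ^ i) =
      ∑ i ∈ Finset.range μ, qExpansion 1 (c i) * qExpansion 1 (raisedE₄ N) ^ i := by
  have hh := mem_periodicFun_of_Gam0 (coe_mem_forms (raisedE₄ N))
  have hc' : ∀ i ∈ Finset.range μ, c i ∈ periodicFun := fun i hi ↦
    mem_periodicFun_of_levelOne (hc i (Finset.mem_range.mp hi))
  rw [qExpansion_sum_of_mem _ fun i hi ↦ mul_mem (hc' i hi) (pow_mem hh i)]
  refine Finset.sum_congr rfl fun i hi ↦ ?_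
  rw [qExpansion_mul_of_mem (hc' i hi) (pow_mem hh i), qExpansion_pow_of_mem hh]

theorem exists_qExpansion_eq_map_sum (σ : ℂ →+* ℂ)
    (hc : ∀ i < μ, c i ∈ forms 𝒮ℒ (k + (μ - 1 - i : ℕ) * 4)) :
    ∃ F' ∈ forms (Gam0 N) (k + (μ - 1 : ℕ) * 4),
      qExpansion 1 F' = (qExpansion 1 (∑ i ∈ Finset.range μ, c i * ⇑(raisedE₄ N) ^ i)).map σ := by
  have := fun i (hi : i < μ) ↦ exists_levelOne_qExpansion_eq_map σ (k + (μ - 1 - i) * 4)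
    (by push_cast; rfl) (hc i hi)
  choose! c' hc' hq using this
  obtain ⟨A, hA⟩ := exists_int_qExpansion_raisedE₄ (N := N)
  refine ⟨_, sum_mul_raisedE₄_mem_forms hc', ?_⟩
  rw [qExpansion_sum_mul_raisedE₄ hc', qExpansion_sum_mul_raisedE₄ hc, map_sum]
  refine Finset.sum_congr rfl fun i hi ↦ ?_
  rw [hq i (Finset.mem_range.mp hi), map_mul, map_pow, ← hA]
  congr 2
  ext n
  simp

theorem mapLin_qExpansion_sum_mem (φ : ℂ →ₗ[ℚ] ℚ)
    (hc : ∀ i < μ, c i ∈ forms 𝒮ℒ (k + (μ - 1 - i : ℕ) * 4)) :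
    mapLin φ (qExpansion 1 (∑ i ∈ Finset.range μ, c i * ⇑(raisedE₄ N) ^ i)) ∈ bddDenom := by
  obtain ⟨A, hA⟩ := exists_int_qExpansion_raisedE₄ (N := N)
  have hA' : qExpansion 1 (raisedE₄ N) = (A.map (Int.castRingHom ℚ)).map (algebraMap ℚ ℂ) := by
    rw [← hA]
    ext n
    simp
  rw [qExpansion_sum_mul_raisedE₄ hc, map_sum]
  refine sum_mem fun i hi ↦ ?_
  rw [hA', ← map_pow, mapLin_mul_map]
  exact mul_mem (mapLin_qExpansion_levelOne_mem φ (k + (μ - 1 - i) * 4) (by push_cast; rfl)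
    (hc i (Finset.mem_range.mp hi))) (pow_mem (map_mem_bddDenom A) i)

theorem exists_different_raisedE₄_eq_sum : ∃ c : ℕ → ℍ → ℂ,
    (∀ i < μ, c i ∈ forms 𝒮ℒ ((0 : ℕ) + (μ - 1 - i : ℕ) * 4)) ∧
      different (raisedE₄ N) = ∑ i ∈ Finset.range μ, c i * ⇑(raisedE₄ N) ^ i := by
  obtain ⟨c, hc, h⟩ := exists_mul_different_eq_sum (raisedE₄ N) (1 : ModularForm (Gam0 N) 0)
  exact ⟨c, hc, by rwa [ModularForm.one_coe_eq_one, one_mul] at h⟩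

theorem exists_qExpansion_relation {F : ℍ → ℂ} (hF : F ∈ forms (Gam0 N) k) : ∃ P : ℕ → ℍ → ℂ,
    P 0 = 1 ∧ (∀ i ≤ μ, P i ∈ forms 𝒮ℒ (i * k)) ∧
    ∑ i ∈ Finset.range (μ + 1), qExpansion 1 (P i) * qExpansion 1 F ^ (μ - i) = 0 := by
  obtain ⟨f, rfl⟩ := hF
  obtain ⟨P, hP0, hP, hrel⟩ := exists_levelOne_relation f
  refine ⟨P, hP0, hP, ?_⟩
  have hf := mem_periodicFun_of_Gam0 (coe_mem_forms f)
  have hP' : ∀ i ∈ Finset.range (μ + 1), P i ∈ periodicFun := fun i hi ↦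
    mem_periodicFun_of_levelOne (hP i (by simpa [Nat.lt_succ_iff] using hi))
  have := congrArg (qExpansion 1) hrel
  rw [qExpansion_sum_of_mem _ fun i hi ↦ mul_mem (hP' i hi) (pow_mem hf _), qExpansion_zero] at this
  rw [← this]
  refine Finset.sum_congr rfl fun i hi ↦ ?_
  rw [qExpansion_mul_of_mem (hP' i hi) (pow_mem hf _), qExpansion_pow_of_mem hf]

/-- The Galois conjugates of modular forms are modular forms. -/
theorem exists_qExpansion_eq_map (σ : ℂ →+* ℂ) {F : ℍ → ℂ} (hF : F ∈ forms (Gam0 N) k) :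
    ∃ F' ∈ forms (Gam0 N) k, qExpansion 1 F' = (qExpansion 1 F).map σ := by
  have hpF := mem_periodicFun_of_Gam0 hF
  obtain ⟨P, hP0, hP, hrel⟩ := exists_qExpansion_relation hF
  obtain ⟨b, hb, hD⟩ := exists_different_raisedE₄_eq_sum (N := N)
  have hDmem : different (raisedE₄ N) ∈ periodicFun := by
    rw [hD]
    exact mem_periodicFun_of_Gam0 (sum_mul_raisedE₄_mem_forms hb)
  obtain ⟨c, hc, hA⟩ : ∃ c : ℕ → ℍ → ℂ, (∀ i < μ, c i ∈ forms 𝒮ℒ (k + (μ - 1 - i : ℕ) * 4)) ∧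
      F * different (raisedE₄ N) = ∑ i ∈ Finset.range μ, c i * ⇑(raisedE₄ N) ^ i := by
    obtain ⟨f, rfl⟩ := hF
    exact exists_mul_different_eq_sum (raisedE₄ N) f
  obtain ⟨G', hG', hqG⟩ := exists_qExpansion_eq_map_sum σ hb
  obtain ⟨A', hA', hqA⟩ := exists_qExpansion_eq_map_sum σ hc
  rw [← hD] at hqG
  rw [← hA, qExpansion_mul_of_mem hpF hDmem, map_mul, ← hqG] at hqA
  have hG0 : qExpansion 1 G' ≠ 0 := by
    rw [hqG, Ne, map_eq_zero_iff _ (map_injective σ σ.injective)]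
    intro h
    refine different_raisedE₄_ne_zero N (eq_of_qExpansion_eq hDmem (zero_mem _) ?_)
    rw [h, qExpansion_zero]
  have hpG := mem_periodicFun_of_Gam0 hG'
  have hpA := mem_periodicFun_of_Gam0 hA'
  have := fun i (hi : i ≤ μ) ↦ exists_levelOne_qExpansion_eq_map σ (i * k) (by push_cast; rfl) (hP i hi)
  choose! P' hP' hqP using this
  have hP'0 : P' 0 = 1 := by
    refine eq_of_qExpansion_eq (mem_periodicFun_of_levelOne (hP' 0 (Nat.zero_le _))) (one_mem _) ?_
    rw [hqP 0 (Nat.zero_le _), hP0, qExpansion_one, map_one]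
  have hpP : ∀ i ∈ Finset.range (μ + 1), P' i ∈ periodicFun := fun i hi ↦
    mem_periodicFun_of_levelOne (hP' i (by simpa [Nat.lt_succ_iff] using hi))
  -- Conjugating the relation for F and multiplying by G'^μ shows that A'/G' is integral over level
  -- one, hence a modular form.
  have hrel' : ∑ i ∈ Finset.range (μ + 1), P' i * G' ^ i * A' ^ (μ - i) = 0 := by
    have hpi := fun i hi ↦ mul_mem (mul_mem (hpP i hi) (pow_mem hpG i)) (pow_mem hpA (μ - i))
    refine eq_of_qExpansion_eq (sum_mem hpi) (zero_mem _) ?_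
    have h := congrArg (map σ) hrel
    rw [map_sum, map_zero] at h
    rw [qExpansion_zero, qExpansion_sum_of_mem _ hpi, ← mul_zero (qExpansion 1 G' ^ μ), ← h,
      Finset.mul_sum]
    refine Finset.sum_congr rfl fun i hi ↦ ?_
    have hi' : i ≤ μ := by simpa [Nat.lt_succ_iff] using hi
    rw [qExpansion_mul_of_mem (mul_mem (hpP i hi) (pow_mem hpG i)) (pow_mem hpA _),
      qExpansion_mul_of_mem (hpP i hi) (pow_mem hpG i), qExpansion_pow_of_mem hpG,
      qExpansion_pow_of_mem hpA, hqA, hqP i hi', map_mul, map_pow, mul_pow]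
    rw [show qExpansion 1 G' ^ μ = qExpansion 1 G' ^ i * qExpansion 1 G' ^ (μ - i) by
      rw [← pow_add]; congr 1; omega]
    ring
  obtain ⟨F', hF', hFG⟩ := exists_mem_forms_mul_eq (by push_cast; ring) hA' hG'
    (fun h ↦ hG0 (by rw [h, qExpansion_zero])) μ P' hP' hP'0 hrel'
  refine ⟨F', hF', mul_right_cancel₀ hG0 ?_⟩
  rw [← hqA, ← hFG, qExpansion_mul_of_mem (mem_periodicFun_of_Gam0 hF') hpG]

/-- The coefficients of the relation have weight at most μk < 12m, so their bases have at most m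
elements and none that is nonzero vanishes to order m. -/
theorem qExpansion_eq_zero_of_X_pow_dvd {F : ℍ → ℂ} (hF : F ∈ forms (Gam0 N) k) {m : ℕ}
    (hm : μ * k < 12 * m) (h : X ^ m ∣ qExpansion 1 F) : qExpansion 1 F = 0 := by
  obtain ⟨P, hP0, hP, hrel⟩ := exists_qExpansion_relation hF
  refine eq_zero_of_X_pow_dvd_of_relation h μ (fun i ↦ qExpansion 1 (P i)) (fun i hi hdvd ↦ ?_)
    ⟨0, Nat.zero_le _, ?_⟩ hrel
  · obtain ⟨d, b, hd, hb, -, hspan⟩ := exists_levelOne_basis (i * k)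
    obtain ⟨x, hx⟩ := hspan (P i) (by exact_mod_cast hP i hi)
    have hik : i * k ≤ μ * k := Nat.mul_le_mul_right k hi
    rw [hx] at hdvd
    rw [hx, hb.eq_zero x (by omega) hdvd]
    simp
  · simp [hP0, qExpansion_one]

theorem exists_dual_eq_one {x : ℂ} (hx : x ≠ 0) : ∃ φ : ℂ →ₗ[ℚ] ℚ, φ x = 1 :=
  Module.Projective.exists_dual_eq_one ℚ hx

theorem mem_bddDenom_of_map_eq_qExpansion {F : ℍ → ℂ} (hF : F ∈ forms (Gam0 N) k)
    {r : PowerSeries ℚ} (hr : r.map (algebraMap ℚ ℂ) = qExpansion 1 F) : r ∈ bddDenom := by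
  have hpF := mem_periodicFun_of_Gam0 hF
  obtain ⟨P, hP0, hP, hrel⟩ := exists_qExpansion_relation hF
  obtain ⟨b, hb, hD⟩ := exists_different_raisedE₄_eq_sum (N := N)
  have hDmem : different (raisedE₄ N) ∈ periodicFun := by
    rw [hD]
    exact mem_periodicFun_of_Gam0 (sum_mul_raisedE₄_mem_forms hb)
  obtain ⟨c, hc, hA⟩ : ∃ c : ℕ → ℍ → ℂ, (∀ i < μ, c i ∈ forms 𝒮ℒ (k + (μ - 1 - i : ℕ) * 4)) ∧
      F * different (raisedE₄ N) = ∑ i ∈ Finset.range μ, c i * ⇑(raisedE₄ N) ^ i := by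
    obtain ⟨f, rfl⟩ := hF
    exact exists_mul_different_eq_sum (raisedE₄ N) f
  have hG0 : qExpansion 1 (different (raisedE₄ N)) ≠ 0 := fun h ↦
    different_raisedE₄_ne_zero N (eq_of_qExpansion_eq hDmem (zero_mem _) (by rw [h, qExpansion_zero]))
  obtain ⟨n, hn⟩ := exists_coeff_ne_zero_iff_ne_zero.mpr hG0
  -- φ keeps the denominator nonzero; ψ fixes 1, so the relation stays monic over ℚ.
  obtain ⟨φ, hφ⟩ := exists_dual_eq_one hn
  obtain ⟨ψ, hψ⟩ := exists_dual_eq_one (one_ne_zero (α := ℂ))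
  refine mem_bddDenom_of_relation (G := mapLin φ (qExpansion 1 (different (raisedE₄ N)))) ?_ ?_ ?_ μ
    (fun i ↦ mapLin ψ (qExpansion 1 (P i))) ?_ ?_ ?_
  · rw [hD]
    exact mapLin_qExpansion_sum_mem φ hb
  · intro h
    have := congrArg (coeff n) h
    rw [coeff_mapLin, hφ] at this
    exact one_ne_zero this
  · rw [← mapLin_mul_map, hr, mul_comm, ← qExpansion_mul_of_mem hpF hDmem, hA]
    exact mapLin_qExpansion_sum_mem φ hc
  · exact fun i hi ↦ mapLin_qExpansion_levelOne_mem ψ (i * k) (by push_cast; rfl) (hP i hi)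
  · rw [hP0, qExpansion_one, mapLin_one hψ]
  · have h := congrArg (mapLin ψ) hrel
    rw [map_sum, map_zero] at h
    rw [← h]
    refine Finset.sum_congr rfl fun i _ ↦ ?_
    rw [← hr, ← map_pow, mapLin_mul_map]

theorem exists_int_coeff_of_map_eq_qExpansion {F : ℍ → ℂ} (hF : F ∈ forms (Gam0 N) k) {m : ℕ}
    (hm : μ * k < 12 * m) {r : PowerSeries ℚ} (hr : r.map (algebraMap ℚ ℂ) = qExpansion 1 F)
    (hint : ∀ i < m, ∃ z : ℤ, (z : ℚ) = coeff i r) (i : ℕ) : ∃ z : ℤ, (z : ℚ) = coeff i r := by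
  obtain ⟨P, hP0, hP, hrel⟩ := exists_qExpansion_relation hF
  obtain ⟨ψ, hψ⟩ := exists_dual_eq_one (one_ne_zero (α := ℂ))
  choose d b hd hb _ hspan using fun i ↦ exists_levelOne_basis (i * k)
  have hx : ∀ i ≤ μ, ∃ x : Fin (d i) → ℂ,
      qExpansion 1 (P i) = ∑ j, x j • (b i j).map (Int.castRingHom ℂ) := fun i hi ↦
    hspan i (P i) (by exact_mod_cast hP i hi)
  choose! x hx using hx
  have hφ : ∀ i ≤ μ, mapLin ψ (qExpansion 1 (P i)) =
      ∑ j, ψ (x i j) • (b i j).map (Int.castRingHom ℚ) := fun i hi ↦ by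
    rw [hx i hi, map_sum]
    exact Finset.sum_congr rfl fun j _ ↦ mapLin_smul_map_int _ _ _
  refine exists_int_coeff_of_relation (m := m) (n := μ) b hb (fun i hi ↦ ?_) (fun i j ↦ ψ (x i j))
    ⟨0, Nat.zero_le _, fun h ↦ ?_⟩ ?_ (mem_bddDenom_of_map_eq_qExpansion hF hr) hint i
  · have hik : i * k ≤ μ * k := Nat.mul_le_mul_right k hi
    have := hd i
    omega
  · have h0 := hφ 0 (Nat.zero_le _)
    rw [hP0, qExpansion_one, mapLin_one hψ] at h0
    refine one_ne_zero (h0.trans (Finset.sum_eq_zero fun j _ ↦ ?_))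
    rw [congrFun h j, Pi.zero_apply, zero_smul]
  · have h := congrArg (mapLin ψ) hrel
    rw [map_sum, map_zero] at h
    rw [← h]
    refine Finset.sum_congr rfl fun i hi ↦ ?_
    rw [← hφ i (by simpa [Nat.lt_succ_iff] using hi), ← hr, ← map_pow, mapLin_mul_map]

/-- The coefficients of a modular form are integral combinations of the first ones. -/
theorem exists_coeffInf_eq_sum_int {m : ℕ} (hm : μ * k < 12 * m) (n : ℕ) :
    ∃ z : Fin m → ℤ, ∀ F ∈ forms (Gam0 N) k, coeffInf F n = ∑ i, (z i : ℂ) * coeffInf F i := by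
  set V : Submodule ℂ (PowerSeries ℂ) :=
    ((forms (Gam0 N) k).comap periodicFun.val.toLinearMap).map qHom.toLinearMap with hV
  have hmem : ∀ f, f ∈ V ↔ ∃ F ∈ forms (Gam0 N) k, qExpansion 1 F = f := fun f ↦
    ⟨fun ⟨F, hF, h⟩ ↦ ⟨F.1, hF, h⟩, fun ⟨F, hF, h⟩ ↦ ⟨⟨F, mem_periodicFun_of_Gam0 hF⟩, hF, h⟩⟩
  suffices h : ∃ z : Fin m → ℤ, ∀ f ∈ V, coeff n f = ∑ i : Fin m, (z i : ℂ) * coeff (i : ℕ) f by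
    obtain ⟨z, hz⟩ := h
    exact ⟨z, fun F hF ↦ hz _ ((hmem _).mpr ⟨F, hF, rfl⟩)⟩
  refine exists_coeff_eq_sum_int V m ?_ ?_ ?_ n
  · intro f hf h
    obtain ⟨F, hF, rfl⟩ := (hmem f).mp hf
    exact qExpansion_eq_zero_of_X_pow_dvd hF hm (X_pow_dvd_iff.mpr h)
  · intro σ f hf
    obtain ⟨F, hF, rfl⟩ := (hmem f).mp hf
    exact (hmem _).mpr (exists_qExpansion_eq_map σ hF)
  · intro r hr
    obtain ⟨F, hF, h⟩ := (hmem _).mp hr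
    exact exists_int_coeff_of_map_eq_qExpansion hF hm h.symm

end Gam0

end EisCongr

/-! ### Transfer of congruences and conclusion. -/

namespace EisCongr

/-- Numbers of λ-order at least r form a group: denominators multiply, and stay outside λ because it
is prime. -/
theorem congrMod_of_sub_eq_sum {K : IntermediateField ℚ ℂ} {lam : Ideal (𝓞 K)} [lam.IsPrime] {r : ℕ}
    {ι : Type*} (s : Finset ι) (z : ι → ℤ) (x y : ι → ℂ) {u v : ℂ}
    (h : ∀ i ∈ s, CongrMod K lam r (x i) (y i)) (huv : u - v = ∑ i ∈ s, (z i : ℂ) * (x i - y i)) :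
    CongrMod K lam r u v := by
  classical
  induction s using Finset.induction_on generalizing u v with
  | empty =>
    refine ⟨0, zero_mem _, 1, (Ideal.ne_top_iff_one lam).mp Ideal.IsPrime.ne_top', ?_⟩
    rw [huv]
    simp
  | insert i s hi ih =>
    rw [Finset.sum_insert hi] at huv
    obtain ⟨a, ha, c, hc, hac⟩ := h i (Finset.mem_insert_self i s)
    obtain ⟨b, hb, d, hd, hbd⟩ := ih (u := ∑ i ∈ s, (z i : ℂ) * (x i - y i)) (v := 0)
      (fun j hj ↦ h j (Finset.mem_insert_of_mem hj)) (sub_zero _)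
    refine ⟨z i * d * a + c * b, add_mem (Ideal.mul_mem_left _ _ ha) (Ideal.mul_mem_left _ _ hb),
      c * d, fun hcd ↦ (Ideal.IsPrime.mem_or_mem ‹_› hcd).elim hc hd, ?_⟩
    rw [sub_zero] at hbd
    rw [huv]
    have hz : (((z i : 𝓞 K) : K) : ℂ) = z i :=
      map_intCast ((algebraMap K ℂ).comp (algebraMap (𝓞 K) K)) (z i)
    push_cast
    rw [hz]
    linear_combination (z i : ℂ) * d * hac + (c : ℂ) * hbd

theorem cuspForm_mem_forms {N : ℕ} {k : ℤ} (f : Sk N k) : ⇑f ∈ forms (Gam0 N) k :=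
  ⟨{ toFun := f
     slash_action_eq' := f.slash_action_eq'
     holo' := f.holo'
     bdd_at_cusps' := fun hc ↦ ModularFormClass.bdd_at_cusps f hc }, rfl⟩

end EisCongr

theorem theorem5 (t : ℕ) (p : Fin t → ℕ) (hp : ∀ i, (p i).Prime) (hinj : Function.Injective p)
    (N : ℕ) (hN : N = ∏ i, p i) (k : ℤ) (hk : 2 ≤ k)
    (f : EisCongr.Sk N k) (hf : EisCongr.IsNewform f)
    (r : ℕ) (lam : Ideal (𝓞 (EisCongr.coeffField f))) (hlam : lam.IsMaximal)
    (E : EisCongr.Mk N k) (hEis : EisCongr.IsEisenstein E) (hE : EisCongr.IsHeckeEigen N k E)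
    (hcong : ∀ n : ℕ, (n : ℝ) ≤ (k : ℝ) * (∏ i, ((p i : ℝ) + 1)) / 12 →
      EisCongr.CongrMod (EisCongr.coeffField f) lam r
        (EisCongr.coeffInf f n) (EisCongr.coeffInf E n)) :
    ∀ n : ℕ, EisCongr.CongrMod (EisCongr.coeffField f) lam r
      (EisCongr.coeffInf f n) (EisCongr.coeffInf E n) := by
  intro n
  subst hN
  lift k to ℕ using by omega
  have : NeZero (∏ i, p i) := ⟨Finset.prod_ne_zero_iff.mpr fun i _ ↦ (hp i).ne_zero⟩
  have hprime := hlam.isPrime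
  -- Natural number division: B is the last index covered by the hypothesis, so m = B + 1
  -- coefficients are available and 12(B + 1) exceeds k∏(p_i+1).
  set B := k * (∏ i, (p i + 1)) / 12 with hB
  have hm : Fintype.card (EisCongr.Cosets (EisCongr.Gam0 (∏ i, p i))) * k < 12 * (B + 1) := by
    have h1 := Nat.mul_le_mul_right k (EisCongr.card_cosets_Gam0_le p hp hinj)
    rw [mul_comm (∏ i, (p i + 1))] at h1
    omega
  obtain ⟨z, hz⟩ := EisCongr.exists_coeffInf_eq_sum_int hm n
  refine EisCongr.congrMod_of_sub_eq_sum Finset.univ z (fun i ↦ EisCongr.coeffInf f i)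
    (fun i ↦ EisCongr.coeffInf E i) (fun i _ ↦ hcong i ?_) ?_
  · have hi : (i : ℕ) ≤ B := Nat.lt_succ_iff.mp i.2
    have h12 : (i : ℕ) * 12 ≤ k * ∏ i, (p i + 1) :=
      (Nat.mul_le_mul_right 12 hi).trans (Nat.div_mul_le_self _ _)
    rw [le_div_iff₀ (by norm_num)]
    exact_mod_cast h12
  · rw [hz _ (EisCongr.cuspForm_mem_forms f), hz _ (EisCongr.coe_mem_forms E), ← Finset.sum_sub_distrib]
    simp only [mul_sub]
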